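/- Let $A=(a_{ij})_{i,j\in\mathcal I}$ be a generalized Cartan matrix with $\mathcal I$ finite, let $(\mathfrak h,\Pi=\{\alpha_i\},\Pi^\vee=\{\alpha_i^\vee\})$ be a (minimal) realization of $A$ over $\mathbb C$, with $\langle\alpha_j,\alpha_i^\vee\rangle=a_{ij}$, and let $\mathfrak g=\mathfrak g(A)$ be the Kac–Moody algebra: the quotient of the Lie algebra generated by $e_i,f_i$ $(i\in\mathcal I)$ and $\mathfrak h$ subject to the Chevalley and Serre relations by the largest ideal intersecting $\mathfrak h$ trivially. Let $\Delta\subset\mathfrak h^*$ be its root system and $\Delta^+=\Delta\cap\mathbb Z_{\ge0}\Pi$. Write $\mathfrak g_J=\mathfrak g(A_{J\times J})$ for $J\subseteq\mathcal I$, and $W_J$ for the group generated by the simple reflections $s_j$, $j\in J$, acting on $\mathfrak h^*$. "Semisimple" means finite-dimensional semisimple. For $x=\sum_i c_i\alpha_i\in\mathbb C\Pi$ put $\operatorname{supp}(x)=\{i: c_i\ne0\}$ and $\operatorname{ht}_I(x)=\sum_{i\in I}c_i$. For $\alpha\in\Delta^+$ and $J\subseteq\mathcal I$ put $\Delta_{\alpha,J}=\{\beta\in\Delta^+:\operatorname{supp}(\beta-\alpha)\subseteq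 J\}$; for $\emptyset\ne I\subseteq\mathcal I$ put $\Delta_{I,1}=\{\beta\in\Delta:\operatorname{ht}_I(\beta)=1\}$, $\Pi_I=\{\alpha_i:i\in I\}$, $I^c=\mathcal I\setminus I$. **(A)** Let $\alpha\in\Delta^+$ and $J\subseteq\mathcal I\setminus\operatorname{supp}(\alpha)$. The following are equivalent: 1. $\Delta_{\alpha,J}$ is finite. 2. $W_J\alpha$ is finite. 3. The set of cosets of $W_J$ modulo the parabolic subgroup $\langle s_j : j\in J,\ \langle\alpha,\alpha_j^\vee\rangle=0\rangle$ is finite. 4. If $J\neq\emptyset$, there is a nonempty $J'\subseteq J$ such that $\mathfrak g_{J'}$ is semisimple and $\Delta_{\alpha,J}=\Delta_{\alpha,J'}$. Moreover, if the Dynkin subdiagram on $J$ is connected and $\Delta_{\alpha,J}\supsetneq\{\alpha\}$, then every $J'\subseteq J$ with $\mathfrak g_{J'}$ semisimple and $\Delta_{\alpha,J}=\Delta_{\alpha,J'}$ is equal to $J$. **(B)** Let $\emptyset\neq I\subsetneq\mathcal I$. The following are equivalent: 1. $\Delta_{I,1}$ is finite. 2. $W_{I^c}\Pi_I$ is finite.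 3. For each $i\in I$, the set of cosets of $W_{I^c}$ modulo the parabolic subgroup $\langle s_t : t\in I^c,\ \langle\alpha_i,\alpha_t^\vee\rangle=0\rangle$ is finite. 4. For each $i\in I$ there is a nonempty $J_i\subseteq I^c$ such that $\mathfrak g_{J_i}$ is semisimple and $\Delta_{\alpha_i,I^c}=\Delta_{\alpha_i,J_i}$. Moreover, suppose that the Dynkin subdiagram on $I^c$ is connected and $\Delta_{I,1}\supsetneq\Pi_I$. If $\Delta_{I,1}$ is finite, then $\mathfrak g_{I^c}$ is semisimple, so that one may take $J_i=I^c$ in (4) for every $i\in I$. For every $i\in I$ with $\Delta_{\alpha_i,I^c}\supsetneq\{\alpha_i\}$, every $J_i\subseteq I^c$ with $\mathfrak g_{J_i}$ semisimple and $\Delta_{\alpha_i,I^c}=\Delta_{\alpha_i,J_i}$ is equal to $I^c$. -/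

import Mathlib

noncomputable section

/-- A generalized Cartan matrix with index set `ι`. -/
structure GCM (ι : Type*) where
  /-- the entries; `entry i j` is `⟨α_j, α_i^∨⟩` -/
  entry : Matrix ι ι ℤ
  diag : ∀ i, entry i i = 2
  nonpos : ∀ i j, i ≠ j → entry i j ≤ 0
  zero_symm : ∀ i j, entry i j = 0 → entry j i = 0

namespace GCM

variable {ι : Type*}

/-- The principal submatrix on a subset `J` of the index set. -/
def restrict (A : GCM ι) (J : Set ι) : GCM J where
  entry := A.entry.submatrix (fun j => (j : ι)) (fun j => (j : ι))
  diag i := A.diag i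
  nonpos i j h := A.nonpos i j (fun e => h (Subtype.ext e))
  zero_symm i j h := A.zero_symm i j h

/-- The Dynkin diagram, as a simple graph (multiplicities and arrows of the edges are irrelevant
for connectedness). -/
def dynkin (A : GCM ι) : SimpleGraph ι where
  Adj i j := i ≠ j ∧ (A.entry i j ≠ 0 ∨ A.entry j i ≠ 0)
  symm := ⟨fun _ _ h => ⟨h.1.symm, h.2.symm⟩⟩
  loopless := ⟨fun _ h => h.1 rfl⟩

/-- The Cartan matrix with complex entries. -/
def complexEntry (A : GCM ι) : Matrix ι ι ℂ := A.entry.map (Int.cast : ℤ → ℂ)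

end GCM

/-- A (minimal) realization `(𝔥, Π, Π^∨)` over `ℂ` of a generalized Cartan matrix. -/
structure Realization {ι : Type*} [Fintype ι] (A : GCM ι)
    (𝔥 : Type*) [AddCommGroup 𝔥] [Module ℂ 𝔥] where
  /-- the simple roots `α_i` -/
  root : ι → Module.Dual ℂ 𝔥
  /-- the simple coroots `α_i^∨` -/
  coroot : ι → 𝔥
  root_linearIndependent : LinearIndependent ℂ root
  coroot_linearIndependent : LinearIndependent ℂ coroot
  root_coroot : ∀ i j, root j (coroot i) = (A.entry i j : ℂ)
  finite_dim : FiniteDimensional ℂ 𝔥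
  /-- `dim 𝔥 = 2 n - rank A` -/
  finrank_add_rank : Module.finrank ℂ 𝔥 + A.complexEntry.rank = 2 * Fintype.card ι

namespace Realization

variable {ι : Type*} [Fintype ι] {A : GCM ι} {𝔥 : Type*} [AddCommGroup 𝔥] [Module ℂ 𝔥]

/-! ### The Kac-Moody algebra of a realization -/

/-- Generators of the Kac-Moody algebra: `e_i`, `f_i` and the elements of `𝔥`. -/
inductive Gen (ι 𝔥 : Type*)
  | e : ι → Gen ι 𝔥
  | f : ι → Gen ι 𝔥
  | h : 𝔥 → Gen ι 𝔥

/-- `e_i` in the free Lie algebra. -/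
abbrev freeE (𝔥 : Type*) {ι : Type*} (i : ι) : FreeLieAlgebra ℂ (Gen ι 𝔥) :=
  FreeLieAlgebra.of ℂ (Gen.e i)

/-- `f_i` in the free Lie algebra. -/
abbrev freeF (𝔥 : Type*) {ι : Type*} (i : ι) : FreeLieAlgebra ℂ (Gen ι 𝔥) :=
  FreeLieAlgebra.of ℂ (Gen.f i)

/-- `h ∈ 𝔥` in the free Lie algebra. -/
abbrev freeH (ι : Type*) {𝔥 : Type*} (h : 𝔥) : FreeLieAlgebra ℂ (Gen ι 𝔥) :=
  FreeLieAlgebra.of ℂ (Gen.h h)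

/-- The elements of the free Lie algebra that are set equal to zero: linearity of `𝔥` in the
generators, the Chevalley relations and the Serre relations. -/
inductive Relator (R : Realization A 𝔥) : FreeLieAlgebra ℂ (Gen ι 𝔥) → Prop
  | add (h h' : 𝔥) : Relator R (freeH ι (h + h') - (freeH ι h + freeH ι h'))
  | smul (c : ℂ) (h : 𝔥) : Relator R (freeH ι (c • h) - c • freeH ι h)
  | hh (h h' : 𝔥) : Relator R ⁅freeH ι h, freeH ι h'⁆
  | he (h : 𝔥) (i : ι) : Relator R (⁅freeH ι h, freeE 𝔥 i⁆ - R.root i h • freeE 𝔥 i)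
  | hf (h : 𝔥) (i : ι) : Relator R (⁅freeH ι h, freeF 𝔥 i⁆ + R.root i h • freeF 𝔥 i)
  | ef_same (i : ι) : Relator R (⁅freeE 𝔥 i, freeF 𝔥 i⁆ - freeH ι (R.coroot i))
  | ef_ne (i j : ι) (hij : i ≠ j) : Relator R ⁅freeE 𝔥 i, freeF 𝔥 j⁆
  | serre_e (i j : ι) (hij : i ≠ j) :
      Relator R (((LieAlgebra.ad ℂ (FreeLieAlgebra ℂ (Gen ι 𝔥)) (freeE 𝔥 i)) ^
        (1 - A.entry i j).toNat) (freeE 𝔥 j))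
  | serre_f (i j : ι) (hij : i ≠ j) :
      Relator R (((LieAlgebra.ad ℂ (FreeLieAlgebra ℂ (Gen ι 𝔥)) (freeF 𝔥 i)) ^
        (1 - A.entry i j).toNat) (freeF 𝔥 j))

/-- The ideal generated by the relations. -/
def relIdeal (R : Realization A 𝔥) : LieIdeal ℂ (FreeLieAlgebra ℂ (Gen ι 𝔥)) :=
  LieSubmodule.lieSpan ℂ _ {x | R.Relator x}

/-- The Lie algebra generated by `e_i`, `f_i`, `𝔥` subject to the Chevalley and Serre
relations. -/
abbrev PreKM (R : Realization A 𝔥) : Type _ := FreeLieAlgebra ℂ (Gen ι 𝔥) ⧸ R.relIdeal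

/-- The image of an element of `𝔥`. -/
def preCartan (R : Realization A 𝔥) (h : 𝔥) : R.PreKM :=
  LieSubmodule.Quotient.mk (N := R.relIdeal) (freeH ι h)

/-- The largest ideal that intersects (the image of) `𝔥` trivially, as the sum of all such
ideals. -/
def maxIdeal (R : Realization A 𝔥) : LieIdeal ℂ R.PreKM :=
  sSup {I | ∀ h : 𝔥, R.preCartan h ∈ I → R.preCartan h = 0}

/-- The Kac-Moody algebra `𝔤(A)` with the given realization. -/
abbrev KM (R : Realization A 𝔥) : Type _ := R.PreKM ⧸ R.maxIdeal

/-- The map `𝔥 → 𝔤(A)`. -/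
def cartan (R : Realization A 𝔥) (h : 𝔥) : R.KM :=
  LieSubmodule.Quotient.mk (N := R.maxIdeal) (R.preCartan h)

/-! ### Roots -/

/-- The root system `Δ ⊆ 𝔥^*`: the nonzero weights of the adjoint action of `𝔥` on `𝔤(A)`. -/
def roots (R : Realization A 𝔥) : Set (Module.Dual ℂ 𝔥) :=
  {β | β ≠ 0 ∧ ∃ x : R.KM, x ≠ 0 ∧ ∀ h : 𝔥, ⁅R.cartan h, x⁆ = β h • x}

/-- The positive roots `Δ^+ = Δ ∩ ℤ_{≥0} Π`. -/
def posRoots (R : Realization A 𝔥) : Set (Module.Dual ℂ 𝔥) :=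
  {β | β ∈ R.roots ∧ ∃ c : ι → ℕ, β = ∑ i, c i • R.root i}

open Classical in
/-- The coefficients `c_i` of `x = ∑ c_i α_i ∈ ℂ Π` (zero if `x ∉ ℂ Π`). -/
def coeff (R : Realization A 𝔥) (x : Module.Dual ℂ 𝔥) : ι → ℂ :=
  if h : ∃ c : ι → ℂ, x = ∑ i, c i • R.root i then h.choose else 0

theorem coeff_sum (R : Realization A 𝔥) (c : ι → ℂ) :
    R.coeff (∑ i, c i • R.root i) = c := by
  classical
  have h : ∃ d : ι → ℂ, (∑ i, c i • R.root i) = ∑ i, d i • R.root i := ⟨c, rfl⟩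
  have e : R.coeff (∑ i, c i • R.root i) = h.choose := by
    unfold coeff
    rw [dif_pos h]
  rw [e]
  have hs := h.choose_spec
  have hl := Fintype.linearIndependent_iff.1 R.root_linearIndependent
    (fun i => h.choose i - c i) (by simp only [sub_smul, Finset.sum_sub_distrib]; rw [← hs, sub_self])
  funext i
  exact sub_eq_zero.1 (hl i)

/-- The support of a vector of `ℂ Π`. -/
def supp (R : Realization A 𝔥) (x : Module.Dual ℂ 𝔥) : Set ι := {i | R.coeff x i ≠ 0}

/-- The `I`-height: the sum of the coefficients over `I`. -/
def heightOn (R : Realization A 𝔥) (I : Set ι) (x : Module.Dual ℂ 𝔥) : ℂ :=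
  ∑ i, I.indicator (R.coeff x) i

/-- `Δ_{α,J}`: the positive roots `β` with `supp (β - α) ⊆ J`. -/
def slice (R : Realization A 𝔥) (α : Module.Dual ℂ 𝔥) (J : Set ι) : Set (Module.Dual ℂ 𝔥) :=
  {β | β ∈ R.posRoots ∧ R.supp (β - α) ⊆ J}

/-- `Δ_{I,n}`: the roots of `I`-height `n`. -/
def rootsOfHeight (R : Realization A 𝔥) (I : Set ι) (n : ℤ) : Set (Module.Dual ℂ 𝔥) :=
  {β | β ∈ R.roots ∧ R.heightOn I β = n}

/-! ### Weyl group -/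

/-- The simple reflection `s_i` of `𝔥^*`: `s_i μ = μ - ⟨μ, α_i^∨⟩ α_i`. -/
def simpleRefl (R : Realization A 𝔥) (i : ι) : Module.Dual ℂ 𝔥 ≃ₗ[ℂ] Module.Dual ℂ 𝔥 :=
  Module.reflection (x := R.root i) (f := Module.Dual.eval ℂ 𝔥 (R.coroot i))
    (by rw [Module.Dual.eval_apply, R.root_coroot, A.diag]; norm_num)

theorem simpleRefl_apply (R : Realization A 𝔥) (i : ι) (μ : Module.Dual ℂ 𝔥) :
    R.simpleRefl i μ = μ - μ (R.coroot i) • R.root i := by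
  simp [simpleRefl, Module.reflection_apply]

/-- The parabolic subgroup `W_J` of the Weyl group, generated by `s_j` for `j ∈ J`. -/
def parabolic (R : Realization A 𝔥) (J : Set ι) :
    Subgroup (Module.Dual ℂ 𝔥 ≃ₗ[ℂ] Module.Dual ℂ 𝔥) :=
  Subgroup.closure (R.simpleRefl '' J)

/-- `W_J S`, the union of the `W_J`-orbits of the elements of `S`. -/
def orbit (R : Realization A 𝔥) (J : Set ι) (S : Set (Module.Dual ℂ 𝔥)) :
    Set (Module.Dual ℂ 𝔥) :=
  {μ | ∃ w ∈ R.parabolic J, ∃ ν ∈ S, μ = w ν}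

/-- The nodes `j ∈ J` with `⟨α, α_j^∨⟩ = 0`. -/
def orthNodes (R : Realization A 𝔥) (α : Module.Dual ℂ 𝔥) (J : Set ι) : Set ι :=
  {j | j ∈ J ∧ α (R.coroot j) = 0}

/-- The coset space of `W_J` modulo `⟨s_j | j ∈ J, ⟨α, α_j^∨⟩ = 0⟩`. -/
abbrev cosets (R : Realization A 𝔥) (α : Module.Dual ℂ 𝔥) (J : Set ι) : Type _ :=
  R.parabolic J ⧸ (R.parabolic (R.orthNodes α J)).subgroupOf (R.parabolic J)

end Realization

/-! ### A concrete realization, and semisimplicity of `𝔤_J` -/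

namespace GCM

variable {ι : Type*} [Fintype ι]

/-- The space of the standard realization, `ℂ^ι × ker A`. -/
abbrev StdCartan (A : GCM ι) : Type _ := (ι → ℂ) × LinearMap.ker A.complexEntry.mulVecLin

/-- The simple roots of the standard realization: `α_j (v, k) = ∑ i, v_i a_{ij} + k_j`. -/
def stdRoot (A : GCM ι) (j : ι) : Module.Dual ℂ A.StdCartan :=
  (∑ i, (A.entry i j : ℂ) • (LinearMap.proj i : (ι → ℂ) →ₗ[ℂ] ℂ)).comp (LinearMap.fst ℂ _ _) +
    ((LinearMap.proj j : (ι → ℂ) →ₗ[ℂ] ℂ).comp (Submodule.subtype _)).comp (LinearMap.snd ℂ _ _)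

theorem stdRoot_apply (A : GCM ι) (j : ι) (x : A.StdCartan) :
    A.stdRoot j x = ∑ i, (A.entry i j : ℂ) * x.1 i + x.2.1 j := by
  simp [stdRoot]

open Classical in
/-- The standard realization on `ℂ^ι × ker A`, with coroots the standard basis of `ℂ^ι`. -/
def stdRealization (A : GCM ι) : Realization A A.StdCartan where
  root := A.stdRoot
  coroot i := (Pi.single i 1, 0)
  root_linearIndependent := by
    rw [Fintype.linearIndependent_iff]
    intro g hg
    have key : ∀ x : A.StdCartan, ∑ j, g j * A.stdRoot j x = 0 := by
      intro x
      have := congrArg (fun φ : Module.Dual ℂ A.StdCartan => φ x) hg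
      simpa [LinearMap.sum_apply] using this
    have hk : ∀ i, ∑ j, (A.entry i j : ℂ) * g j = 0 := by
      intro i
      have h := key (Pi.single i 1, 0)
      simp only [stdRoot_apply] at h
      simpa [Pi.single_apply, mul_comm] using h
    have hc : (fun j => (starRingEnd ℂ) (g j)) ∈ LinearMap.ker A.complexEntry.mulVecLin := by
      rw [LinearMap.mem_ker]
      funext i
      have h := congrArg (starRingEnd ℂ) (hk i)
      simpa [Matrix.mulVec, dotProduct, complexEntry] using h
    have h := key (0, ⟨_, hc⟩)
    simp only [stdRoot_apply] at h
    simp only [Pi.zero_apply, mul_zero, Finset.sum_const_zero, zero_add, Complex.mul_conj] at h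
    have h' : ∑ j, Complex.normSq (g j) = 0 := by exact_mod_cast h
    intro i
    have := (Finset.sum_eq_zero_iff_of_nonneg
      (fun j _ => Complex.normSq_nonneg (g j))).1 h' i (Finset.mem_univ i)
    exact Complex.normSq_eq_zero.1 this
  coroot_linearIndependent := by
    rw [Fintype.linearIndependent_iff]
    intro g hg i
    have := congrFun (congrArg Prod.fst hg) i
    simpa [Prod.fst_sum, Finset.sum_apply, Pi.single_apply] using this
  root_coroot i j := by
    simp [stdRoot_apply, Pi.single_apply]
  finite_dim := inferInstance
  finrank_add_rank := by
    have h := LinearMap.finrank_range_add_finrank_ker A.complexEntry.mulVecLin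
    have e : Module.finrank ℂ A.StdCartan =
        Module.finrank ℂ (ι → ℂ) +
          Module.finrank ℂ (LinearMap.ker A.complexEntry.mulVecLin) := Module.finrank_prod
    rw [e, Matrix.rank]
    simp only [Module.finrank_fintype_fun_eq_card] at *
    omega

open Classical in
/-- The Kac-Moody algebra `𝔤_J = 𝔤(A_{J × J})` is a (finite-dimensional) semisimple Lie algebra.
Up to isomorphism `𝔤_J` does not depend on the realization of `A_{J × J}`, and the standard one is
used. -/
def SemisimpleOn (A : GCM ι) (J : Set ι) : Prop :=
  FiniteDimensional ℂ (A.restrict J).stdRealization.KM ∧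
    LieAlgebra.IsSemisimple ℂ (A.restrict J).stdRealization.KM

end GCM

end

/-! The pivot is the set L of nodes of J whose connected component in J contains a node not
orthogonal to α (`linkedNodes`). A node of J outside L is orthogonal both to supp α and to L. Since
supports of roots are connected, no root of the slice involves such a node
(`slice_eq_slice_linkedNodes`); its reflection fixes α and commutes with W_L, so every element of
W_J is one of W_L times one of the parabolic subgroup in (3) (`exists_mul_of_mem_parabolic`). All
the finiteness conditions in (A) therefore amount to L being of finite type, i.e. A_{L×L} having a
positive definite symmetrization (`FiniteTypeOn`), and `semisimpleOn_iff` translates finite type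
into semisimplicity.

A finite orbit X = W_J α forces L to be of finite type: summing μ(α_k^∨) μ(α_i^∨) over μ in X gives
a reflection-invariant positive semidefinite form on the coroots, which symmetrizes the Cartan
matrix, and a Perron–Frobenius argument shows that it is definite on L (`finiteTypeOn_linkedNodes`).
Conversely, over a finite type subset the slice is finite, because β ↦ (β,β) − (α,α) is invariant
under reflections and nonpositive on antidominant members of the slice, so that it confines β − α to
a bounded set (`slice_finite`). The group W_L is finite as well (`parabolic_finite`), whence
finitely many cosets; no identification of the stabilizer of α is needed.

The roots enter through few facts: they are plus or minus nonnegative combinations of simple roots,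
they are permuted by the reflections, their supports are connected, and the simple roots occur.
These come from the triangular decomposition, sl₂ theory and the vanishing of brackets that mix
orthogonal letters, together with the embedding of 𝔥 in 𝔤(A), which is detected on irreducible
highest weight modules (`preCartan_eq_zero`).

Part (B) reduces to (A): the roots of I-height one are the union of the slices through the α_i with
i in I (`rootsOfHeight_one`). -/

noncomputable section

open LieAlgebra

/-! ### Linear algebra of simultaneous eigenvectors. -/

/-- Simultaneous eigenvector components of an element of a stable submodule lie in the
submodule. -/
theorem weight_component_mem {T V : Type*} [AddCommGroup V] [Module ℂ V] (op : T → V →ₗ[ℂ] V)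
    (N : Submodule ℂ V) (hN : ∀ t, ∀ v ∈ N, op t v ∈ N) (Γ : Finset (T → ℂ)) :
    ∀ x : (T → ℂ) → V, (∀ γ t, op t (x γ) = γ t • x γ) → ∑ γ ∈ Γ, x γ ∈ N →
      ∀ γ ∈ Γ, x γ ∈ N := by
  classical
  induction Γ using Finset.induction_on with
  | empty => simp
  | insert δ Γ hδ ih =>
    intro x hx hsum
    have key : ∀ γ ∈ Γ, x γ ∈ N := by
      intro γ hγ
      have hne : γ ≠ δ := fun h => hδ (h ▸ hγ)
      obtain ⟨t, ht⟩ := Function.ne_iff.1 hne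
      -- The operator at t minus δ t kills the δ-component and rescales the others, with nonzero
      -- factor at the chosen γ.
      have h1 : ∑ γ ∈ Γ, (γ t - δ t) • x γ ∈ N := by
        have h2 := N.sub_mem (hN t _ hsum) (N.smul_mem (δ t) hsum)
        rw [map_sum, Finset.smul_sum, ← Finset.sum_sub_distrib, Finset.sum_insert hδ] at h2
        simpa [hx, sub_smul] using h2
      have h3 := ih (fun γ => (γ t - δ t) • x γ)
        (fun γ s => by rw [map_smul, hx, smul_comm]) h1 γ hγ
      exact (N.smul_mem_iff (sub_ne_zero.2 ht)).1 h3
    intro γ hγ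
    rcases Finset.mem_insert.1 hγ with rfl | hγ
    · rw [Finset.sum_insert hδ] at hsum
      exact (N.add_mem_iff_left (N.sum_mem key)).1 hsum
    · exact key γ hγ

/-- If a combination of simultaneous eigenvectors lies in a stable submodule, then so does its
part of a given weight. -/
theorem weight_part_mem {T V κ : Type*} [AddCommGroup V] [Module ℂ V] (op : T → V →ₗ[ℂ] V)
    (N : Submodule ℂ V) (hN : ∀ t, ∀ v ∈ N, op t v ∈ N) (g : κ → V) (wt : κ → T → ℂ)
    (hg : ∀ k t, op t (g k) = wt k t • g k) (s : Finset κ) (c : κ → ℂ)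
    (hsum : ∑ k ∈ s, c k • g k ∈ N) (β : T → ℂ) [DecidablePred fun k => wt k = β] :
    ∑ k ∈ s with wt k = β, c k • g k ∈ N := by
  classical
  by_cases hβ : β ∈ s.image wt
  · have h := weight_component_mem op N hN (s.image wt)
      (fun γ => ∑ k ∈ s with wt k = γ, c k • g k) (fun γ t => by
        rw [map_sum, Finset.smul_sum]
        refine Finset.sum_congr rfl fun k hk => ?_
        rw [map_smul, hg, (Finset.mem_filter.1 hk).2, smul_comm]) (by
        rwa [Finset.sum_fiberwise_of_maps_to (fun k hk => Finset.mem_image_of_mem wt hk)])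
      β hβ
    convert h
  · rw [Finset.sum_eq_zero]
    · exact N.zero_mem
    · intro k hk
      rw [Finset.mem_filter] at hk
      exact absurd (Finset.mem_image.2 ⟨k, hk.1, hk.2⟩) hβ

/-- A simultaneous eigenvector in the span of simultaneous eigenvectors is in the span of those
with the same weight. -/
theorem mem_span_of_weight {T V κ : Type*} [AddCommGroup V] [Module ℂ V] (op : T → V →ₗ[ℂ] V)
    (g : κ → V) (wt : κ → T → ℂ) (hg : ∀ k t, op t (g k) = wt k t • g k) {x : V} {β : T → ℂ}
    (hx : ∀ t, op t x = β t • x) (hspan : x ∈ Submodule.span ℂ (Set.range g)) :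
    x ∈ Submodule.span ℂ (g '' {k | wt k = β}) := by
  classical
  obtain ⟨c, rfl⟩ := Finsupp.mem_span_range_iff_exists_finsupp.1 hspan
  set x := c.sum fun k a => a • g k with hxdef
  -- Adjoin x itself, under the index `none`, with coefficient −1: the total is zero, and its β-part
  -- expresses x by generators of weight β.
  have h := weight_part_mem op ⊥ (by simp) (fun o : Option κ => o.elim x g)
    (fun o => o.elim β wt) (by rintro (_ | k) t <;> simp [hx, hg])
    (insert none (c.support.image some)) (fun o => o.elim (-1) c) (by
      rw [Finset.sum_insert (by simp), Finset.sum_image (by simp)]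
      simp [hxdef, Finsupp.sum]) β
  rw [Finset.filter_insert, if_pos (show (none : Option κ).elim β wt = β from rfl),
    Finset.sum_insert (by simp), Submodule.mem_bot] at h
  simp only [Option.elim_none, neg_smul, one_smul] at h
  rw [neg_add_eq_zero] at h
  rw [h]
  refine Submodule.sum_mem _ fun o ho => Submodule.smul_mem _ _ (Submodule.subset_span ?_)
  simp only [Finset.mem_filter, Finset.mem_image] at ho
  obtain ⟨⟨k, -, rfl⟩, hk⟩ := ho
  exact ⟨k, hk, rfl⟩

/-! ### Chevalley relations and the rank-one computation. -/

/-- Elements of a Lie algebra that satisfy the Chevalley relations of a realization. -/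
structure ChevalleyData {ι : Type*} [Fintype ι] {A : GCM ι} {𝔥 : Type*} [AddCommGroup 𝔥]
    [Module ℂ 𝔥] (R : Realization A 𝔥) (L : Type*) [LieRing L] [LieAlgebra ℂ L] where
  e : ι → L
  f : ι → L
  H : 𝔥 →ₗ[ℂ] L
  lie_H_H : ∀ h h', ⁅H h, H h'⁆ = 0
  lie_H_e : ∀ h i, ⁅H h, e i⁆ = R.root i h • e i
  lie_H_f : ∀ h i, ⁅H h, f i⁆ = -(R.root i h • f i)
  lie_e_f_same : ∀ i, ⁅e i, f i⁆ = H (R.coroot i)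
  lie_e_f_ne : ∀ i j, i ≠ j → ⁅e i, f j⁆ = 0

namespace ChevalleyData

variable {ι : Type*} [Fintype ι] {A : GCM ι} {𝔥 : Type*} [AddCommGroup 𝔥] [Module ℂ 𝔥]
  {R : Realization A 𝔥} {L : Type*} [LieRing L] [LieAlgebra ℂ L]

/-- The Chevalley involution on Chevalley data. -/
def swap (D : ChevalleyData R L) : ChevalleyData R L where
  e := D.f
  f := D.e
  H := -D.H
  lie_H_H h h' := by simp [D.lie_H_H]
  lie_H_e h i := by simp [D.lie_H_f]
  lie_H_f h i := by simp [D.lie_H_e]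
  lie_e_f_same i := by rw [← lie_skew, D.lie_e_f_same]; simp
  lie_e_f_ne i j hij := by rw [← lie_skew, D.lie_e_f_ne j i hij.symm, neg_zero]

variable (D : ChevalleyData R L)

@[simp] theorem swap_H (h : 𝔥) : D.swap.H h = -D.H h := rfl

/-- `x` is an eigenvector (or zero) of weight `β` of the Cartan subalgebra. -/
def IsWeight (β : Module.Dual ℂ 𝔥) (x : L) : Prop := ∀ h, ⁅D.H h, x⁆ = β h • x

theorem isWeight_swap {β : Module.Dual ℂ 𝔥} {x : L} :
    D.swap.IsWeight β x ↔ D.IsWeight (-β) x := by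
  simp only [IsWeight, swap_H, neg_lie, LinearMap.neg_apply, neg_smul, neg_eq_iff_eq_neg]

variable {D}

theorem IsWeight.lie_e {β : Module.Dual ℂ 𝔥} {x : L} (hx : D.IsWeight β x) (i : ι) :
    D.IsWeight (β + R.root i) ⁅D.e i, x⁆ := by
  intro h
  rw [leibniz_lie, D.lie_H_e, hx, smul_lie, lie_smul, LinearMap.add_apply, add_smul, add_comm]

theorem IsWeight.lie_f {β : Module.Dual ℂ 𝔥} {x : L} (hx : D.IsWeight β x) (i : ι) :
    D.IsWeight (β - R.root i) ⁅D.f i, x⁆ := by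
  intro h
  rw [leibniz_lie, D.lie_H_f, hx, neg_lie, smul_lie, lie_smul, LinearMap.sub_apply, sub_smul]
  abel

theorem IsWeight.ad_e_pow {β : Module.Dual ℂ 𝔥} {x : L} (hx : D.IsWeight β x) (i : ι) (n : ℕ) :
    D.IsWeight (β + n • R.root i) ((ad ℂ L (D.e i) ^ n) x) := by
  induction n with
  | zero => simpa using hx
  | succ n ih =>
    rw [pow_succ', Module.End.mul_apply, ad_apply, succ_nsmul, ← add_assoc]
    exact ih.lie_e i

theorem IsWeight.ad_f_pow {β : Module.Dual ℂ 𝔥} {x : L} (hx : D.IsWeight β x) (i : ι) (n : ℕ) :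
    D.IsWeight (β - n • R.root i) ((ad ℂ L (D.f i) ^ n) x) := by
  induction n with
  | zero => simpa using hx
  | succ n ih =>
    rw [pow_succ', Module.End.mul_apply, ad_apply, succ_nsmul, ← sub_sub]
    exact ih.lie_f i

variable (D)

/-- The `sl₂` computation for a primitive vector. -/
theorem lie_e_ad_f_pow (i : ι) {v : L} {μ : ℂ} (he : ⁅D.e i, v⁆ = 0)
    (hH : ⁅D.H (R.coroot i), v⁆ = μ • v) (n : ℕ) :
    ⁅D.e i, (ad ℂ L (D.f i) ^ (n + 1)) v⁆ = ((n + 1) * (μ - n)) • (ad ℂ L (D.f i) ^ n) v := by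
  have hroot : R.root i (R.coroot i) = 2 := by rw [R.root_coroot, A.diag]; norm_num
  have hw : ∀ n : ℕ, ⁅D.H (R.coroot i), (ad ℂ L (D.f i) ^ n) v⁆ =
      (μ - 2 * n) • (ad ℂ L (D.f i) ^ n) v := by
    intro n
    induction n with
    | zero => simpa using hH
    | succ n ih =>
      rw [pow_succ', Module.End.mul_apply, ad_apply, leibniz_lie, ih, D.lie_H_f, hroot, neg_lie,
        smul_lie, lie_smul, ← neg_smul, ← add_smul]
      push_cast
      ring_nf
  induction n with
  | zero =>
    rw [zero_add, pow_one, pow_zero, ad_apply, leibniz_lie, he, D.lie_e_f_same, hH]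
    simp
  | succ n ih =>
    rw [pow_succ', Module.End.mul_apply, ad_apply, leibniz_lie, ih, D.lie_e_f_same, hw, lie_smul,
      ← ad_apply ℂ L (D.f i), ← Module.End.mul_apply, ← pow_succ', ← add_smul]
    push_cast
    ring_nf

/-- The raising operators kill the Serre elements of the lowering operators. -/
theorem lie_e_serre (i j k : ι) (hij : i ≠ j) :
    ⁅D.e k, (ad ℂ L (D.f i) ^ (1 - A.entry i j).toNat) (D.f j)⁆ = 0 := by
  obtain ⟨m, hm⟩ : ∃ m : ℕ, A.entry i j = -m := ⟨(-A.entry i j).toNat, by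
    rw [Int.toNat_of_nonneg (by have := A.nonpos i j hij; omega)]; ring⟩
  have hn : (1 - A.entry i j).toNat = m + 1 := by omega
  rw [hn]
  -- f_j is primitive of weight m for the i-th sl₂, so the factor μ − n of `lie_e_ad_f_pow` vanishes
  -- at n = m, the exponent being m + 1.
  by_cases hki : k = i
  · subst hki
    rw [D.lie_e_ad_f_pow k (μ := m) (D.lie_e_f_ne k j hij)]
    · simp
    · rw [D.lie_H_f, R.root_coroot, hm]; simp
  · have hc : ∀ (n : ℕ) (x : L),
        ⁅D.e k, (ad ℂ L (D.f i) ^ n) x⁆ = (ad ℂ L (D.f i) ^ n) ⁅D.e k, x⁆ := by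
      intro n x
      induction n with
      | zero => rfl
      | succ n ih =>
        rw [pow_succ', Module.End.mul_apply, ad_apply, leibniz_lie, D.lie_e_f_ne k i hki, ih,
          zero_lie, zero_add, Module.End.mul_apply, ad_apply]
    rw [hc]
    -- One ad f_i turns [e_j, f_j] = α_j^∨ into a_{ji} f_i. A further one kills this when m > 0;
    -- when m = 0 the coefficient a_{ji} is zero already.
    by_cases hkj : k = j
    · subst hkj
      rw [D.lie_e_f_same, pow_succ, Module.End.mul_apply, ad_apply, ← lie_skew, D.lie_H_f, neg_neg,
        R.root_coroot]
      rcases Nat.eq_zero_or_pos m with rfl | hpos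
      · rw [A.zero_symm i k (by simpa using hm)]; simp
      · obtain ⟨l, rfl⟩ := Nat.exists_eq_add_of_lt hpos
        rw [map_smul, pow_succ, Module.End.mul_apply, ad_apply, lie_self, map_zero, smul_zero]
    · rw [D.lie_e_f_ne k j hkj, map_zero]

theorem lie_f_serre (i j k : ι) (hij : i ≠ j) :
    ⁅D.f k, (ad ℂ L (D.e i) ^ (1 - A.entry i j).toNat) (D.e j)⁆ = 0 :=
  D.swap.lie_e_serre i j k hij

end ChevalleyData
end

/-! ### Verma modules and the embedding of the Cartan subalgebra. -/

noncomputable section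

open LieAlgebra

set_option linter.unusedSectionVars false

/-- By the universal property the generators lift to a homomorphism into S; followed by the
inclusion it fixes the generators, so it is the identity. -/
theorem FreeLieAlgebra.eq_top_of_forall_of_mem {X : Type*} (S : LieSubalgebra ℂ (FreeLieAlgebra ℂ X))
    (hS : ∀ x, FreeLieAlgebra.of ℂ x ∈ S) : S = ⊤ := by
  have h : S.incl.comp (FreeLieAlgebra.lift ℂ fun x => (⟨_, hS x⟩ : S)) = LieHom.id := by
    ext x
    simp
  refine eq_top_iff.2 fun x _ => ?_
  have hx := LieHom.congr_fun h x
  rw [LieHom.comp_apply, LieHom.id_apply] at hx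
  rw [← hx]
  exact SetLike.coe_mem _

namespace Realization

attribute [local instance] LieRing.ofAssociativeRing

variable {ι : Type*} [Fintype ι] {A : GCM ι} {𝔥 : Type*} [AddCommGroup 𝔥] [Module ℂ 𝔥]
  (R : Realization A 𝔥)

/-! ### Verma modules of the Chevalley relations -/

/-- The underlying space of a Verma module: noncommutative polynomials in the `f_i`. -/
abbrev Verma (ι : Type*) : Type _ := List ι →₀ ℂ

/-- The weight of a monomial. -/
def vermaWeight (lam : Module.Dual ℂ 𝔥) (l : List ι) : Module.Dual ℂ 𝔥 :=
  lam - (l.map R.root).sum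

/-- The lowering operators: left multiplication. -/
def vermaF (i : ι) : Module.End ℂ (Verma ι) := Finsupp.lmapDomain ℂ ℂ (List.cons i)

/-- The action of the Cartan subalgebra. -/
def vermaH (lam : Module.Dual ℂ 𝔥) : 𝔥 →ₗ[ℂ] Module.End ℂ (Verma ι) where
  toFun h := Finsupp.linearCombination ℂ fun l =>
    R.vermaWeight lam l h • (Finsupp.single l 1 : Verma ι)
  map_add' h h' := by ext1 l; ext1; simp [add_smul]
  map_smul' c h := by ext1 l; ext1; simp [mul_smul]

open Classical in
/-- The raising operators on monomials. -/
def vermaEAux (lam : Module.Dual ℂ 𝔥) (i : ι) : List ι → Verma ι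
  | [] => 0
  | j :: l => vermaF j (vermaEAux lam i l) +
      if i = j then R.vermaWeight lam l (R.coroot i) • Finsupp.single l 1 else 0

/-- The raising operators. -/
def vermaE (lam : Module.Dual ℂ 𝔥) (i : ι) : Module.End ℂ (Verma ι) :=
  Finsupp.linearCombination ℂ (R.vermaEAux lam i)

variable (lam : Module.Dual ℂ 𝔥)

theorem vermaF_single (i : ι) (l : List ι) :
    vermaF i (Finsupp.single l 1) = Finsupp.single (i :: l) 1 := by
  simp [vermaF]

theorem vermaH_single (h : 𝔥) (l : List ι) :
    R.vermaH lam h (Finsupp.single l 1) = R.vermaWeight lam l h • Finsupp.single l 1 := by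
  simp [vermaH]

theorem vermaE_single (i : ι) (l : List ι) :
    R.vermaE lam i (Finsupp.single l 1) = R.vermaEAux lam i l := by
  simp [vermaE]

theorem vermaWeight_cons (i : ι) (l : List ι) :
    R.vermaWeight lam (i :: l) = R.vermaWeight lam l - R.root i := by
  simp only [vermaWeight, List.map_cons, List.sum_cons]; abel

theorem Verma.hom_ext {T T' : Module.End ℂ (Verma ι)}
    (h : ∀ l, T (Finsupp.single l 1) = T' (Finsupp.single l 1)) : T = T' :=
  Finsupp.lhom_ext' fun l => LinearMap.ext_ring (h l)

theorem vermaH_vermaF (h : 𝔥) (i : ι) (v : Verma ι) :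
    R.vermaH lam h (vermaF i v) = vermaF i (R.vermaH lam h v) - R.root i h • vermaF i v := by
  suffices R.vermaH lam h * vermaF i = vermaF i * R.vermaH lam h - R.root i h • vermaF i from
    LinearMap.congr_fun this v
  refine Verma.hom_ext fun l => ?_
  simp only [Module.End.mul_apply, LinearMap.sub_apply, LinearMap.smul_apply, vermaF_single,
    vermaH_single, map_smul, vermaWeight_cons, sub_smul]

theorem vermaH_vermaEAux (h : 𝔥) (i : ι) (l : List ι) :
    R.vermaH lam h (R.vermaEAux lam i l) =
      (R.vermaWeight lam l h + R.root i h) • R.vermaEAux lam i l := by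
  induction l with
  | nil => simp [vermaEAux]
  | cons j l ih =>
    rw [vermaEAux, map_add, vermaH_vermaF, ih, map_smul, ← sub_smul, smul_add, vermaWeight_cons,
      LinearMap.sub_apply]
    congr 1
    · ring_nf
    · split_ifs with hij
      · subst hij
        rw [map_smul, vermaH_single, sub_add_cancel, smul_comm]
      · simp

/-- The Verma module with highest weight `lam`. -/
def vermaData : ChevalleyData R (Module.End ℂ (Verma ι)) where
  e := R.vermaE lam
  f := vermaF
  H := R.vermaH lam
  lie_H_H h h' := Verma.hom_ext fun l => by
    simp only [Ring.lie_def, LinearMap.sub_apply, Module.End.mul_apply, vermaH_single, map_smul,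
      LinearMap.zero_apply]
    rw [smul_comm, sub_self]
  lie_H_e h i := Verma.hom_ext fun l => by
    simp only [Ring.lie_def, LinearMap.sub_apply, Module.End.mul_apply, vermaH_single, map_smul,
      vermaE_single, vermaH_vermaEAux, LinearMap.smul_apply, add_smul]
    abel
  lie_H_f h i := LinearMap.ext fun v => by
    simp only [Ring.lie_def, LinearMap.sub_apply, Module.End.mul_apply, vermaH_vermaF,
      LinearMap.neg_apply, LinearMap.smul_apply]
    abel
  lie_e_f_same i := Verma.hom_ext fun l => by
    simp [Ring.lie_def, vermaF_single, vermaE_single, vermaEAux, vermaH_single]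
  lie_e_f_ne i j hij := Verma.hom_ext fun l => by
    simp [Ring.lie_def, vermaF_single, vermaE_single, vermaEAux, hij]

/-- A composite of raising operators. -/
def vermaWord : List ι → Module.End ℂ (Verma ι)
  | [] => 1
  | i :: l => vermaWord l * R.vermaE lam i

/-- The vectors from which the raising operators cannot reach the highest weight vector. -/
def vermaRadical : Submodule ℂ (Verma ι) where
  carrier := {v | ∀ l, R.vermaWord lam l v [] = 0}
  zero_mem' l := by simp
  add_mem' {v w} hv hw l := by simp [hv l, hw l]
  smul_mem' c v hv l := by simp [hv l]

theorem vermaF_apply_nil (i : ι) (v : Verma ι) : vermaF i v [] = 0 :=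
  Finsupp.mapDomain_of_notMem_range _ _ (by simp)

theorem vermaH_apply_nil (h : 𝔥) (v : Verma ι) : R.vermaH lam h v [] = lam h * v [] := by
  suffices Finsupp.lapply [] ∘ₗ R.vermaH lam h = lam h • Finsupp.lapply [] from
    LinearMap.congr_fun this v
  refine Finsupp.lhom_ext' fun l => LinearMap.ext_ring ?_
  simp only [LinearMap.comp_apply, Finsupp.lsingle_apply, vermaH_single, map_smul,
    Finsupp.lapply_apply, LinearMap.smul_apply]
  cases l <;> simp [vermaWeight]

theorem vermaE_mem_radical (i : ι) {v : Verma ι} (hv : v ∈ R.vermaRadical lam) :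
    R.vermaE lam i v ∈ R.vermaRadical lam :=
  fun l => hv (i :: l)

/-- The relation between 𝔥 and e_i moves the Cartan operator past each raising operator, until it
only rescales the coefficient at the highest weight vector. -/
theorem vermaH_mem_radical (h : 𝔥) {v : Verma ι} (hv : v ∈ R.vermaRadical lam) :
    R.vermaH lam h v ∈ R.vermaRadical lam := by
  intro l
  induction l generalizing v with
  | nil =>
    have := hv []
    simp only [vermaWord, Module.End.one_apply] at this ⊢
    rw [vermaH_apply_nil, this, mul_zero]
  | cons i l ih =>
    have h1 := LinearMap.congr_fun ((R.vermaData lam).lie_H_e h i) v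
    simp only [Ring.lie_def, LinearMap.sub_apply, Module.End.mul_apply,
      LinearMap.smul_apply, vermaData] at h1
    rw [sub_eq_iff_eq_add', ← sub_eq_iff_eq_add] at h1
    have hv' := R.vermaE_mem_radical lam i hv
    rw [vermaWord, Module.End.mul_apply, ← h1, map_sub, map_smul, Finsupp.sub_apply,
      Finsupp.smul_apply, ih hv', hv' l, smul_zero, sub_zero]

/-- Moving f_i past a raising operator costs at most a Cartan term, already known to preserve the
radical; once no raising operator is left, the image of f_i has no component at the highest weight
vector. -/
theorem vermaF_mem_radical (i : ι) {v : Verma ι} (hv : v ∈ R.vermaRadical lam) :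
    vermaF i v ∈ R.vermaRadical lam := by
  intro l
  induction l generalizing v with
  | nil => simp [vermaWord, vermaF_apply_nil]
  | cons j l ih =>
    rw [vermaWord, Module.End.mul_apply]
    have hv' := ih (R.vermaE_mem_radical lam j hv)
    by_cases hji : j = i
    · subst hji
      have h1 := LinearMap.congr_fun ((R.vermaData lam).lie_e_f_same j) v
      simp only [Ring.lie_def, LinearMap.sub_apply, Module.End.mul_apply, vermaData] at h1
      rw [sub_eq_iff_eq_add] at h1
      rw [h1, map_add, Finsupp.add_apply, hv', R.vermaH_mem_radical lam _ hv l, add_zero]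
    · have h1 := LinearMap.congr_fun ((R.vermaData lam).lie_e_f_ne j i hji) v
      simp only [Ring.lie_def, LinearMap.sub_apply, Module.End.mul_apply, vermaData,
        LinearMap.zero_apply, sub_eq_zero] at h1
      rw [h1, hv']

theorem ad_pow_apply_of_apply_eq_zero {V W : Type*} [AddCommGroup V] [Module ℂ V]
    [AddCommGroup W] [Module ℂ W] (ε : V →ₗ[ℂ] W) (x y : Module.End ℂ V)
    (hx : ∀ v, ε (x v) = 0) (hy : ∀ v, ε (y v) = 0) (n : ℕ) (v : V) :
    ε ((ad ℂ (Module.End ℂ V) x ^ n) y v) = 0 := by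
  induction n generalizing v with
  | zero => simpa using hy v
  | succ n ih =>
    rw [pow_succ', Module.End.mul_apply, ad_apply, Ring.lie_def, LinearMap.sub_apply, map_sub,
      Module.End.mul_apply, Module.End.mul_apply, hx, ih, sub_zero]

theorem ad_pow_apply_eq_zero {V : Type*} [AddCommGroup V] [Module ℂ V] (x y : Module.End ℂ V)
    {v : V} (hx : x v = 0) (hy : y v = 0) (n : ℕ) :
    (ad ℂ (Module.End ℂ V) x ^ n) y v = 0 := by
  induction n with
  | zero => simpa using hy
  | succ n ih =>
    rw [pow_succ', Module.End.mul_apply, ad_apply, Ring.lie_def, LinearMap.sub_apply,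
      Module.End.mul_apply, Module.End.mul_apply, hx, ih, map_zero, map_zero, sub_zero]

/-- By `lie_e_serre` the Serre element commutes with all raising operators, so any word passes
through it; its image has no component at the highest weight vector. -/
theorem verma_serre_f_mem_radical (i j : ι) (hij : i ≠ j) (v : Verma ι) :
    (ad ℂ (Module.End ℂ (Verma ι)) (vermaF i) ^ (1 - A.entry i j).toNat) (vermaF j) v ∈
      R.vermaRadical lam := by
  intro l
  induction l generalizing v with
  | nil =>
    exact ad_pow_apply_of_apply_eq_zero (Finsupp.lapply []) (vermaF i) (vermaF j)
      (vermaF_apply_nil i) (vermaF_apply_nil j) _ v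
  | cons k l ih =>
    have h1 := LinearMap.congr_fun ((R.vermaData lam).lie_e_serre i j k hij) v
    simp only [Ring.lie_def, LinearMap.sub_apply, Module.End.mul_apply, vermaData,
        LinearMap.zero_apply, sub_eq_zero] at h1
    rw [vermaWord, Module.End.mul_apply]
    erw [h1]
    exact ih _

/-- The element commutes with all lowering operators and kills the highest weight vector, which
generates the module under them. So it vanishes on the whole Verma module, not only modulo the
radical. -/
theorem verma_serre_e_eq_zero (i j : ι) (hij : i ≠ j) :
    (ad ℂ (Module.End ℂ (Verma ι)) (R.vermaE lam i) ^ (1 - A.entry i j).toNat)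
      (R.vermaE lam j) = 0 := by
  refine Verma.hom_ext fun l => ?_
  induction l with
  | nil =>
    exact ad_pow_apply_eq_zero _ _ (by rw [vermaE_single, vermaEAux])
      (by rw [vermaE_single, vermaEAux]) _
  | cons k l ih =>
    have h1 := LinearMap.congr_fun ((R.vermaData lam).lie_f_serre i j k hij)
      (Finsupp.single l 1 : Verma ι)
    simp only [Ring.lie_def, LinearMap.sub_apply, Module.End.mul_apply, vermaData,
        LinearMap.zero_apply, sub_eq_zero] at h1
    rw [← vermaF_single]
    refine h1.symm.trans ?_
    erw [ih]
    simp

/-- The action of the free Lie algebra on a Verma module. -/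
def vermaRep : FreeLieAlgebra ℂ (Gen ι 𝔥) →ₗ⁅ℂ⁆ Module.End ℂ (Verma ι) :=
  FreeLieAlgebra.lift ℂ fun
    | .e i => R.vermaE lam i
    | .f i => vermaF i
    | .h h => R.vermaH lam h

theorem vermaRep_mem_radical (x : FreeLieAlgebra ℂ (Gen ι 𝔥)) {v : Verma ι}
    (hv : v ∈ R.vermaRadical lam) : R.vermaRep lam x v ∈ R.vermaRadical lam := by
  let S : LieSubalgebra ℂ (FreeLieAlgebra ℂ (Gen ι 𝔥)) :=
    { carrier := {x | ∀ v ∈ R.vermaRadical lam, R.vermaRep lam x v ∈ R.vermaRadical lam}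
      zero_mem' := fun v _ => by simp
      add_mem' := fun {x y} hx hy v hv => by
        rw [map_add]; exact add_mem (hx v hv) (hy v hv)
      smul_mem' := fun c x hx v hv => by
        rw [map_smul]; exact Submodule.smul_mem _ c (hx v hv)
      lie_mem' := fun {x y} hx hy v hv => by
        rw [LieHom.map_lie, Ring.lie_def]
        exact sub_mem (hx _ (hy v hv)) (hy _ (hx v hv)) }
  have hS : S = ⊤ := FreeLieAlgebra.eq_top_of_forall_of_mem S (by
    rintro (i | i | h) v hv
    · rw [vermaRep, FreeLieAlgebra.lift_of_apply]; exact R.vermaE_mem_radical lam i hv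
    · rw [vermaRep, FreeLieAlgebra.lift_of_apply]; exact R.vermaF_mem_radical lam i hv
    · rw [vermaRep, FreeLieAlgebra.lift_of_apply]; exact R.vermaH_mem_radical lam h hv)
  have hx : x ∈ S := hS ▸ LieSubalgebra.mem_top x
  exact hx v hv

/-- The elements of the free Lie algebra that annihilate the irreducible quotient of a Verma
module. -/
def vermaAnnihilator : LieIdeal ℂ (FreeLieAlgebra ℂ (Gen ι 𝔥)) where
  carrier := {x | ∀ v, R.vermaRep lam x v ∈ R.vermaRadical lam}
  zero_mem' v := by simp
  add_mem' {x y} hx hy v := by rw [map_add]; exact add_mem (hx v) (hy v)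
  smul_mem' c x hx v := by rw [map_smul]; exact Submodule.smul_mem _ c (hx v)
  lie_mem {x y} hy v := by
    rw [LieHom.map_lie, Ring.lie_def]
    exact sub_mem (R.vermaRep_mem_radical lam x (hy v)) (hy _)

theorem map_ad_pow {L L' : Type*} [LieRing L] [LieAlgebra ℂ L] [LieRing L'] [LieAlgebra ℂ L']
    (φ : L →ₗ⁅ℂ⁆ L') (x y : L) (n : ℕ) :
    φ ((ad ℂ L x ^ n) y) = (ad ℂ L' (φ x) ^ n) (φ y) := by
  induction n with
  | zero => simp
  | succ n ih =>
    rw [pow_succ', pow_succ', Module.End.mul_apply, Module.End.mul_apply, ad_apply, ad_apply,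
      LieHom.map_lie, ih]

/-- Only the Serre relations among the f_i need the passage to the quotient by the radical; all
other relators act by zero on the Verma module. -/
theorem relIdeal_le_vermaAnnihilator : R.relIdeal ≤ R.vermaAnnihilator lam := by
  have hE (i : ι) : R.vermaRep lam (freeE 𝔥 i) = R.vermaE lam i :=
    FreeLieAlgebra.lift_of_apply _ _
  have hF (i : ι) : R.vermaRep lam (freeF 𝔥 i) = vermaF i :=
    FreeLieAlgebra.lift_of_apply _ _
  have hH (h : 𝔥) : R.vermaRep lam (freeH ι h) = R.vermaH lam h :=
    FreeLieAlgebra.lift_of_apply _ _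
  have hzero (x : FreeLieAlgebra ℂ (Gen ι 𝔥)) (hx : R.vermaRep lam x = 0) :
      x ∈ R.vermaAnnihilator lam := fun v => by rw [hx]; simp
  refine LieSubmodule.lieSpan_le.2 fun x hx => ?_
  induction hx with
  | add h h' => exact hzero _ (by simp [hH])
  | smul c h => exact hzero _ (by simp [hH])
  | hh h h' => exact hzero _ (by rw [LieHom.map_lie, hH, hH]; exact (R.vermaData lam).lie_H_H h h')
  | he h i =>
    refine hzero _ ?_
    rw [map_sub, LieHom.map_lie, map_smul, hH, hE, sub_eq_zero]
    exact (R.vermaData lam).lie_H_e h i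
  | hf h i =>
    refine hzero _ ?_
    rw [map_add, LieHom.map_lie, map_smul, hH, hF]
    exact add_eq_zero_iff_eq_neg.2 ((R.vermaData lam).lie_H_f h i)
  | ef_same i =>
    refine hzero _ ?_
    rw [map_sub, LieHom.map_lie, hE, hF, hH, sub_eq_zero]
    exact (R.vermaData lam).lie_e_f_same i
  | ef_ne i j hij =>
    refine hzero _ ?_
    rw [LieHom.map_lie, hE, hF]
    exact (R.vermaData lam).lie_e_f_ne i j hij
  | serre_e i j hij =>
    refine hzero _ ?_
    rw [map_ad_pow, hE, hE, verma_serre_e_eq_zero R lam i j hij]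
  | serre_f i j hij =>
    intro v
    rw [map_ad_pow, hF, hF]
    exact R.verma_serre_f_mem_radical lam i j hij v

/-- The Cartan subalgebra embeds into the algebra given by the Chevalley-Serre relations. -/
theorem preCartan_eq_zero {h : 𝔥} (hh : R.preCartan h = 0) : h = 0 := by
  have hh : freeH ι h ∈ R.relIdeal := (LieSubmodule.Quotient.mk_eq_zero (N := R.relIdeal)).1 hh
  refine (Module.forall_dual_apply_eq_zero_iff ℂ h).1 fun lam => ?_
  -- On the highest weight vector h acts by lam h. This must vanish for every lam, and functionals
  -- separate points.
  have h1 := R.relIdeal_le_vermaAnnihilator lam hh (Finsupp.single [] 1) []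
  rw [vermaRep, FreeLieAlgebra.lift_of_apply, vermaWord, Module.End.one_apply,
    vermaH_apply_nil] at h1
  simpa using h1

end Realization
end

/-! ### Triangular decomposition and reflection invariance of the roots. -/

noncomputable section

open LieAlgebra

set_option linter.unusedSectionVars false

variable {ι : Type*} [Fintype ι] {A : GCM ι} {𝔥 : Type*} [AddCommGroup 𝔥] [Module ℂ 𝔥]
  {R : Realization A 𝔥} {L L' : Type*} [LieRing L] [LieAlgebra ℂ L] [LieRing L'] [LieAlgebra ℂ L']

namespace Realization

/-- The sum of the simple roots in a list of nodes. -/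
def rootSum (R : Realization A 𝔥) (l : List ι) : Module.Dual ℂ 𝔥 := (l.map R.root).sum

@[simp] theorem rootSum_nil (R : Realization A 𝔥) : R.rootSum [] = 0 := rfl

@[simp] theorem rootSum_cons (R : Realization A 𝔥) (i : ι) (l : List ι) :
    R.rootSum (i :: l) = R.root i + R.rootSum l := by simp [rootSum]

theorem rootSum_eq [DecidableEq ι] (R : Realization A 𝔥) (l : List ι) :
    R.rootSum l = ∑ i, (l.count i : ℂ) • R.root i := by
  induction l with
  | nil => simp
  | cons i l ih =>
    rw [rootSum_cons, ih]
    simp [List.count_cons, add_smul, Finset.sum_add_distrib, add_comm]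

theorem sum_root_injective (R : Realization A 𝔥) {c d : ι → ℂ}
    (h : ∑ i, c i • R.root i = ∑ i, d i • R.root i) : c = d := by
  rw [← R.coeff_sum c, h, R.coeff_sum]

theorem rootSum_ne_zero (R : Realization A 𝔥) {l : List ι} (hl : l ≠ []) : R.rootSum l ≠ 0 := by
  classical
  intro h
  rw [rootSum_eq] at h
  have h0 : (fun i => (l.count i : ℂ)) = 0 := R.sum_root_injective (by simpa using h)
  obtain ⟨i, hi⟩ := List.exists_mem_of_ne_nil l hl
  have := congrFun h0 i
  simp only [Pi.zero_apply, Nat.cast_eq_zero, List.count_eq_zero] at this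
  exact this hi

end Realization

namespace ChevalleyData

variable (D : ChevalleyData R L)

@[simp] theorem swap_swap : D.swap.swap = D := by
  cases D; simp [swap]

/-- Iterated brackets of the raising operators. -/
def word : List ι → L
  | [] => 0
  | [i] => D.e i
  | i :: j :: l => ⁅D.e i, word (j :: l)⁆

theorem word_cons {l : List ι} (hl : l ≠ []) (i : ι) : D.word (i :: l) = ⁅D.e i, D.word l⁆ := by
  cases l with
  | nil => exact absurd rfl hl
  | cons j l => rfl

theorem isWeight_e (i : ι) : D.IsWeight (R.root i) (D.e i) := fun h => D.lie_H_e h i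

theorem isWeight_word (l : List ι) : D.IsWeight (R.rootSum l) (D.word l) := by
  induction l with
  | nil => intro h; simp [word]
  | cons i l ih =>
    by_cases hl : l = []
    · subst hl; simpa [word] using D.isWeight_e i
    · rw [D.word_cons hl, R.rootSum_cons, add_comm]
      exact ih.lie_e i

theorem lie_e_word_eq_zero {i : ι} {l : List ι} (h : ∀ j ∈ l, ⁅D.e i, D.e j⁆ = 0) :
    ⁅D.e i, D.word l⁆ = 0 := by
  induction l with
  | nil => simp [word]
  | cons j l ih =>
    by_cases hl : l = []
    · subst hl; simpa [word] using h j (by simp)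
    · rw [D.word_cons hl, leibniz_lie, h j (by simp), ih fun k hk => h k (by simp [hk])]
      simp

theorem word_eq_zero_of_forall_eq {j : ι} {l : List ι} (h : ∀ i ∈ l, i = j)
    (hl : l.length ≠ 1) : D.word l = 0 := by
  match l, h, hl with
  | [], _, _ => rfl
  | [i], _, hl => simp at hl
  | i :: k :: l, h, _ =>
    rw [word]
    refine D.lie_e_word_eq_zero fun m hm => ?_
    rw [h i (by simp), h m (List.mem_cons_of_mem _ hm), lie_self]

/-- Words mixing two commuting sets of letters vanish. -/
theorem word_mixed {S T : Set ι} (hST : ∀ s ∈ S, ∀ t ∈ T, ⁅D.e s, D.e t⁆ = 0) (l : List ι)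
    (hl : ∀ i ∈ l, i ∈ S ∨ i ∈ T) :
    D.word l = 0 ∨ (∀ i ∈ l, i ∈ S) ∨ (∀ i ∈ l, i ∈ T) := by
  induction l with
  | nil => simp [word]
  | cons i l ih =>
    by_cases hnil : l = []
    · subst hnil; right; simpa using hl
    · rw [D.word_cons hnil]
      have hi := hl i (by simp)
      rcases ih fun k hk => hl k (by simp [hk]) with h | h | h
      · left; rw [h, lie_zero]
      · rcases hi with hi | hi
        · right; left; simpa [hi] using h
        · left
          refine D.lie_e_word_eq_zero fun j hj => ?_
          rw [← lie_skew, hST j (h j hj) i hi, neg_zero]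
      · rcases hi with hi | hi
        · left
          exact D.lie_e_word_eq_zero fun j hj => hST i hi j (h j hj)
        · right; right; simpa [hi] using h

/-- The span of the iterated brackets of the raising operators. -/
def wordSpan : Submodule ℂ L := Submodule.span ℂ (Set.range D.word)

theorem word_mem (l : List ι) : D.word l ∈ D.wordSpan := Submodule.subset_span ⟨l, rfl⟩

theorem e_mem_wordSpan (i : ι) : D.e i ∈ D.wordSpan := D.word_mem [i]

/-- The sum of the Cartan subalgebra and the two nilpotent parts. -/
def triangular : Submodule ℂ L := LinearMap.range D.H ⊔ (D.wordSpan ⊔ D.swap.wordSpan)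

theorem H_mem_triangular (h : 𝔥) : D.H h ∈ D.triangular :=
  Submodule.mem_sup_left ⟨h, rfl⟩

theorem wordSpan_le_triangular : D.wordSpan ≤ D.triangular :=
  le_sup_left.trans le_sup_right

theorem swap_triangular : D.swap.triangular = D.triangular := by
  have h : LinearMap.range D.swap.H = LinearMap.range D.H := LinearMap.range_neg _
  rw [triangular, triangular, h, swap_swap, sup_comm D.wordSpan]

theorem lie_e_mem_wordSpan (i : ι) {x : L} (hx : x ∈ D.wordSpan) : ⁅D.e i, x⁆ ∈ D.wordSpan := by
  induction hx using Submodule.span_induction with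
  | mem x hx =>
    obtain ⟨l, rfl⟩ := hx
    by_cases hl : l = []
    · subst hl; simp [word]
    · rw [← D.word_cons hl]; exact D.word_mem _
  | zero => simp
  | add x y _ _ hx hy => rw [lie_add]; exact add_mem hx hy
  | smul c x _ hx => rw [lie_smul]; exact Submodule.smul_mem _ c hx

theorem lie_H_mem_wordSpan (h : 𝔥) {x : L} (hx : x ∈ D.wordSpan) : ⁅D.H h, x⁆ ∈ D.wordSpan := by
  induction hx using Submodule.span_induction with
  | mem x hx =>
    obtain ⟨l, rfl⟩ := hx
    rw [D.isWeight_word l h]; exact Submodule.smul_mem _ _ (D.word_mem _)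
  | zero => simp
  | add x y _ _ hx hy => rw [lie_add]; exact add_mem hx hy
  | smul c x _ hx => rw [lie_smul]; exact Submodule.smul_mem _ c hx

theorem lie_e_H_mem_wordSpan (i : ι) (h : 𝔥) : ⁅D.e i, D.H h⁆ ∈ D.wordSpan := by
  rw [← lie_skew, D.lie_H_e]
  exact neg_mem (Submodule.smul_mem _ _ (D.e_mem_wordSpan i))

/-- Moving f_i through a word with the Leibniz rule produces brackets [f_i, e_j], which lie in the
Cartan part; that part acts on words by scalars. -/
theorem lie_f_mem (i : ι) {x : L} (hx : x ∈ D.wordSpan) :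
    ⁅D.f i, x⁆ ∈ LinearMap.range D.H ⊔ D.wordSpan := by
  have he (j : ι) : ∃ h, ⁅D.f i, D.e j⁆ = D.H h := by
    by_cases hij : j = i
    · subst hij
      exact ⟨-R.coroot j, by rw [← lie_skew, D.lie_e_f_same, map_neg]⟩
    · exact ⟨0, by rw [← lie_skew, D.lie_e_f_ne j i hij, map_zero, neg_zero]⟩
  induction hx using Submodule.span_induction with
  | mem x hx =>
    obtain ⟨l, rfl⟩ := hx
    induction l with
    | nil => simp [word]
    | cons j l ih =>
      obtain ⟨h, hh⟩ := he j
      by_cases hl : l = []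
      · subst hl
        rw [word, hh]
        exact Submodule.mem_sup_left ⟨h, rfl⟩
      · rw [D.word_cons hl, leibniz_lie, hh]
        refine add_mem (Submodule.mem_sup_right (D.lie_H_mem_wordSpan h (D.word_mem l))) ?_
        obtain ⟨_, ⟨h', rfl⟩, y, hy, hxy⟩ := Submodule.mem_sup.1 ih
        rw [← hxy, lie_add]
        exact Submodule.mem_sup_right
          (add_mem (D.lie_e_H_mem_wordSpan j h') (D.lie_e_mem_wordSpan j hy))
  | zero => simp
  | add x y _ _ hx hy => rw [lie_add]; exact add_mem hx hy
  | smul c x _ hx => rw [lie_smul]; exact Submodule.smul_mem _ c hx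

theorem lie_e_mem_triangular (i : ι) {x : L} (hx : x ∈ D.triangular) :
    ⁅D.e i, x⁆ ∈ D.triangular := by
  obtain ⟨_, ⟨h, rfl⟩, z, hz, rfl⟩ := Submodule.mem_sup.1 hx
  obtain ⟨y, hy, w, hw, rfl⟩ := Submodule.mem_sup.1 hz
  rw [lie_add, lie_add]
  refine add_mem (D.wordSpan_le_triangular (D.lie_e_H_mem_wordSpan i h))
    (add_mem (D.wordSpan_le_triangular (D.lie_e_mem_wordSpan i hy)) ?_)
  have h1 := D.swap.lie_f_mem i hw
  rw [← D.swap_triangular]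
  exact (sup_le_sup_left le_sup_left _ : _ ≤ D.swap.triangular) h1

theorem lie_f_mem_triangular (i : ι) {x : L} (hx : x ∈ D.triangular) :
    ⁅D.f i, x⁆ ∈ D.triangular := by
  rw [← D.swap_triangular] at hx ⊢
  exact D.swap.lie_e_mem_triangular i hx

theorem lie_H_mem_triangular (h : 𝔥) {x : L} (hx : x ∈ D.triangular) :
    ⁅D.H h, x⁆ ∈ D.triangular := by
  obtain ⟨_, ⟨h', rfl⟩, z, hz, rfl⟩ := Submodule.mem_sup.1 hx
  obtain ⟨y, hy, w, hw, rfl⟩ := Submodule.mem_sup.1 hz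
  rw [lie_add, lie_add, D.lie_H_H, zero_add]
  refine add_mem (D.wordSpan_le_triangular (D.lie_H_mem_wordSpan h hy)) ?_
  have h1 := D.swap.lie_H_mem_wordSpan (-h) hw
  rw [swap_H, map_neg, neg_neg] at h1
  exact Submodule.mem_sup_right (Submodule.mem_sup_right h1)

end ChevalleyData

/-- Generators of a Lie algebra that satisfy the Chevalley and Serre relations. -/
structure SerreData {ι : Type*} [Fintype ι] {A : GCM ι} {𝔥 : Type*} [AddCommGroup 𝔥]
    [Module ℂ 𝔥] (R : Realization A 𝔥) (L : Type*) [LieRing L] [LieAlgebra ℂ L] extends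
    ChevalleyData R L where
  serre_e : ∀ i j, i ≠ j → (ad ℂ L (e i) ^ (1 - A.entry i j).toNat) (e j) = 0
  serre_f : ∀ i j, i ≠ j → (ad ℂ L (f i) ^ (1 - A.entry i j).toNat) (f j) = 0
  generate : ∀ S : LieSubalgebra ℂ L, (∀ i, e i ∈ S) → (∀ i, f i ∈ S) → (∀ h, H h ∈ S) → S = ⊤

namespace SerreData

/-- The Chevalley involution on Serre data. -/
def swap (D : SerreData R L) : SerreData R L where
  toChevalleyData := D.toChevalleyData.swap
  serre_e := D.serre_f
  serre_f := D.serre_e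
  generate S he hf hH := D.generate S hf he fun h => by simpa using hH h

/-- The image of Serre data under a surjective homomorphism. -/
def map (D : SerreData R L) (φ : L →ₗ⁅ℂ⁆ L') (hφ : Function.Surjective φ) : SerreData R L' where
  e i := φ (D.e i)
  f i := φ (D.f i)
  H := (φ : L →ₗ[ℂ] L') ∘ₗ D.H
  lie_H_H h h' := by
    simp only [LinearMap.comp_apply, LieHom.coe_toLinearMap]
    rw [← LieHom.map_lie, D.lie_H_H, map_zero]
  lie_H_e h i := by
    simp only [LinearMap.comp_apply, LieHom.coe_toLinearMap]
    rw [← LieHom.map_lie, D.lie_H_e, map_smul]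
  lie_H_f h i := by
    simp only [LinearMap.comp_apply, LieHom.coe_toLinearMap]
    rw [← LieHom.map_lie, D.lie_H_f, map_neg, map_smul]
  lie_e_f_same i := by
    simp only [LinearMap.comp_apply, LieHom.coe_toLinearMap]
    rw [← LieHom.map_lie, D.lie_e_f_same]
  lie_e_f_ne i j hij := by rw [← LieHom.map_lie, D.lie_e_f_ne i j hij, map_zero]
  serre_e i j hij := by rw [← Realization.map_ad_pow, D.serre_e i j hij, map_zero]
  serre_f i j hij := by rw [← Realization.map_ad_pow, D.serre_f i j hij, map_zero]
  generate S he hf hH := by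
    have h := D.generate (S.comap φ) he hf hH
    refine eq_top_iff.2 fun y _ => ?_
    obtain ⟨x, rfl⟩ := hφ y
    have hx : x ∈ S.comap φ := h ▸ LieSubalgebra.mem_top x
    exact hx

variable (D : SerreData R L)

/-- The elements whose bracket preserves the triangular sum form a subalgebra containing the
generators, hence everything. The sum is then itself a subalgebra containing the generators. -/
theorem triangular_eq_top : D.triangular = ⊤ := by
  let S : LieSubalgebra ℂ L :=
    { carrier := {x | ∀ y ∈ D.triangular, ⁅x, y⁆ ∈ D.triangular}
      zero_mem' := fun y _ => by simp
      add_mem' := fun {x z} hx hz y hy => by rw [add_lie]; exact add_mem (hx y hy) (hz y hy)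
      smul_mem' := fun c x hx y hy => by rw [smul_lie]; exact Submodule.smul_mem _ c (hx y hy)
      lie_mem' := fun {x z} hx hz y hy => by
        rw [lie_lie]; exact sub_mem (hx _ (hz y hy)) (hz _ (hx y hy)) }
  have hS : S = ⊤ := D.generate S (fun i _ hy => D.lie_e_mem_triangular i hy)
    (fun i _ hy => D.lie_f_mem_triangular i hy) (fun h _ hy => D.lie_H_mem_triangular h hy)
  let T : LieSubalgebra ℂ L :=
    { D.triangular with
      lie_mem' := fun {x y} _ hy => (hS ▸ LieSubalgebra.mem_top x : x ∈ S) y hy }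
  have hT : T = ⊤ := D.generate T (fun i => D.wordSpan_le_triangular (D.e_mem_wordSpan i))
    (fun i => by
      have h : D.f i ∈ D.toChevalleyData.swap.triangular :=
        D.toChevalleyData.swap.wordSpan_le_triangular (D.toChevalleyData.swap.e_mem_wordSpan i)
      rwa [D.toChevalleyData.swap_triangular] at h)
    (fun h => D.H_mem_triangular h)
  exact eq_top_iff.2 fun x _ => (hT ▸ LieSubalgebra.mem_top x : x ∈ T)

/-- A spanning family of weight vectors. -/
def gen : 𝔥 ⊕ List ι ⊕ List ι → L
  | .inl h => D.H h
  | .inr (.inl l) => D.word l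
  | .inr (.inr l) => D.swap.word l

/-- The weights of the spanning family. -/
def genWeight (R : Realization A 𝔥) : 𝔥 ⊕ List ι ⊕ List ι → Module.Dual ℂ 𝔥
  | .inl _ => 0
  | .inr (.inl l) => R.rootSum l
  | .inr (.inr l) => -R.rootSum l

theorem isWeight_gen (k : 𝔥 ⊕ List ι ⊕ List ι) : D.IsWeight (genWeight R k) (D.gen k) := by
  rcases k with h | l | l
  · intro h'; simp [gen, genWeight, D.lie_H_H]
  · exact D.isWeight_word l
  · exact D.toChevalleyData.isWeight_swap.1 (D.swap.isWeight_word l)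

theorem span_gen : Submodule.span ℂ (Set.range D.gen) = ⊤ := by
  rw [← D.triangular_eq_top]
  refine le_antisymm (Submodule.span_le.2 ?_) (sup_le ?_ (sup_le ?_ ?_))
  · rw [D.triangular_eq_top]; exact fun _ _ => Submodule.mem_top
  · rintro _ ⟨h, rfl⟩; exact Submodule.subset_span ⟨.inl h, rfl⟩
  · exact Submodule.span_mono (by rintro _ ⟨l, rfl⟩; exact ⟨.inr (.inl l), rfl⟩)
  · exact Submodule.span_mono (by rintro _ ⟨l, rfl⟩; exact ⟨.inr (.inr l), rfl⟩)

theorem mem_span_gen_of_isWeight {β : Module.Dual ℂ 𝔥} {x : L} (hx : D.IsWeight β x) :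
    x ∈ Submodule.span ℂ (D.gen '' {k | genWeight R k = β}) := by
  have h := mem_span_of_weight (fun h : 𝔥 => (ad ℂ L (D.H h) : L →ₗ[ℂ] L)) D.gen
    (fun k => ⇑(genWeight R k)) (fun k h => D.isWeight_gen k h) (β := ⇑β) hx
    (by rw [D.span_gen]; trivial)
  simpa only [DFunLike.coe_fn_eq] using h

theorem exists_H_of_isWeight_zero {x : L} (hx : D.IsWeight 0 x) : ∃ h, D.H h = x := by
  have h : Submodule.span ℂ (D.gen '' {k | genWeight R k = 0}) ≤ LinearMap.range D.H := by
    refine Submodule.span_le.2 ?_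
    rintro _ ⟨k, hk, rfl⟩
    rcases k with h | l | l
    · exact ⟨h, rfl⟩
    · by_cases hl : l = []
      · subst hl; exact zero_mem _
      · exact absurd hk (R.rootSum_ne_zero hl)
    · by_cases hl : l = []
      · subst hl; exact zero_mem _
      · exact absurd (neg_eq_zero.1 hk) (R.rootSum_ne_zero hl)
  exact h (D.mem_span_gen_of_isWeight hx)

/-- A nonzero vector of nonzero weight has the weight of some nonvanishing word. -/
theorem exists_word {β : Module.Dual ℂ 𝔥} (hβ : β ≠ 0) {x : L} (hx0 : x ≠ 0)
    (hx : D.IsWeight β x) :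
    (∃ l, β = R.rootSum l ∧ D.word l ≠ 0) ∨ ∃ l, β = -R.rootSum l ∧ D.swap.word l ≠ 0 := by
  by_contra! hcon
  have h : Submodule.span ℂ (D.gen '' {k | genWeight R k = β}) ≤ ⊥ := by
    refine Submodule.span_le.2 ?_
    rintro _ ⟨k, hk, rfl⟩
    rcases k with h | l | l
    · exact absurd hk.symm hβ
    · exact hcon.1 l hk.symm
    · exact hcon.2 l hk.symm
  exact hx0 (h (D.mem_span_gen_of_isWeight hx))

/-- An ideal meeting the Cartan subalgebra trivially lies in the sum of the nilpotent parts. -/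
theorem ideal_le_wordSpan (I : LieIdeal ℂ L) (hI : ∀ h, D.H h ∈ I → D.H h = 0) :
    I.toSubmodule ≤ D.wordSpan ⊔ D.swap.wordSpan := by
  classical
  intro x hx
  have hx' : x ∈ Submodule.span ℂ (Set.range D.gen) := by rw [D.span_gen]; trivial
  obtain ⟨c, hc⟩ := Finsupp.mem_span_range_iff_exists_finsupp.1 hx'
  rw [Finsupp.sum] at hc
  -- The weight-zero part of an element of I lies in I, being a weight component, and in the Cartan
  -- part, since nonempty words have nonzero weight. By hypothesis it vanishes.
  have h0 := weight_part_mem (fun h : 𝔥 => (ad ℂ L (D.H h) : L →ₗ[ℂ] L)) I.toSubmodule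
    (fun h v hv => I.lie_mem hv) D.gen
    (fun k => ⇑(genWeight R k)) (fun k h => D.isWeight_gen k h) c.support c (hc ▸ hx) (0 : 𝔥 → ℂ)
  obtain ⟨h, hh⟩ := D.exists_H_of_isWeight_zero (x := ∑ k ∈ c.support with
      ⇑(genWeight R k) = (0 : 𝔥 → ℂ), c k • D.gen k) (fun h => by
    rw [lie_sum, LinearMap.zero_apply, zero_smul]
    refine Finset.sum_eq_zero fun k hk => ?_
    rw [lie_smul, D.isWeight_gen, congrFun (Finset.mem_filter.1 hk).2 h, Pi.zero_apply,
      zero_smul, smul_zero])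
  rw [← hh] at h0
  have h00 := hI h h0
  rw [hh] at h00
  rw [← hc, ← Finset.sum_filter_add_sum_filter_not c.support
    (fun k => ⇑(genWeight R k) = (0 : 𝔥 → ℂ)), h00, zero_add]
  refine Submodule.sum_mem _ fun k hk => Submodule.smul_mem _ _ ?_
  rcases k with h' | l | l
  · exact absurd rfl (Finset.mem_filter.1 hk).2
  · exact Submodule.mem_sup_left (D.word_mem l)
  · exact Submodule.mem_sup_right (D.swap.word_mem l)

/-- The vector has weight zero, whereas the only word of weight zero is the empty one, whose value
is 0. -/
theorem H_eq_zero_of_mem_wordSpan {h : 𝔥} (hh : D.H h ∈ D.wordSpan ⊔ D.swap.wordSpan) :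
    D.H h = 0 := by
  let g : List ι ⊕ List ι → L := fun k => D.gen (.inr k)
  have h1 : D.H h ∈ Submodule.span ℂ (Set.range g) := by
    refine (sup_le ?_ ?_ : D.wordSpan ⊔ D.swap.wordSpan ≤ _) hh
    · exact Submodule.span_mono (by rintro _ ⟨l, rfl⟩; exact ⟨.inl l, rfl⟩)
    · exact Submodule.span_mono (by rintro _ ⟨l, rfl⟩; exact ⟨.inr l, rfl⟩)
  have h2 := mem_span_of_weight (fun h : 𝔥 => (ad ℂ L (D.H h) : L →ₗ[ℂ] L)) g
    (fun k => ⇑(genWeight R (.inr k))) (fun k h => D.isWeight_gen (.inr k) h)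
    (β := (0 : 𝔥 → ℂ)) (fun h' => by simp [D.lie_H_H]) h1
  have h3 : Submodule.span ℂ (g '' {k | ⇑(genWeight R (.inr k)) = (0 : 𝔥 → ℂ)}) ≤ ⊥ := by
    refine Submodule.span_le.2 ?_
    rintro _ ⟨k, hk, rfl⟩
    have hk' : genWeight R (.inr k) = 0 := DFunLike.coe_injective hk
    rcases k with l | l
    · by_cases hl : l = []
      · subst hl; rfl
      · exact absurd hk' (R.rootSum_ne_zero hl)
    · by_cases hl : l = []
      · subst hl; rfl
      · exact absurd (neg_eq_zero.1 hk') (R.rootSum_ne_zero hl)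
  exact h3 h2

/-! ### Local nilpotency and reflections -/

/-- The vectors killed by some power of ad e_i form the Engel subalgebra, so local nilpotency need
only be checked on generators, where it follows from the Chevalley and Serre relations. -/
theorem exists_ad_e_pow_eq_zero (i : ι) (x : L) : ∃ n : ℕ, (ad ℂ L (D.e i) ^ n) x = 0 := by
  rw [← LieSubalgebra.mem_engel_iff]
  have hH (h : 𝔥) : (ad ℂ L (D.e i) ^ 2) (D.H h) = 0 := by
    rw [pow_two, Module.End.mul_apply, ad_apply, ad_apply, ← lie_skew (D.e i) (D.H h), D.lie_H_e]
    simp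
  have h : LieSubalgebra.engel ℂ (D.e i) = ⊤ := by
    refine D.generate _ (fun j => ?_) (fun j => ?_) (fun h => ?_)
    · rw [LieSubalgebra.mem_engel_iff]
      by_cases hij : i = j
      · subst hij; exact ⟨1, by simp⟩
      · exact ⟨_, D.serre_e i j hij⟩
    · rw [LieSubalgebra.mem_engel_iff]
      by_cases hij : i = j
      · subst hij
        exact ⟨3, by rw [pow_succ, Module.End.mul_apply, ad_apply, D.lie_e_f_same, hH]⟩
      · exact ⟨1, by rw [pow_one, ad_apply, D.lie_e_f_ne i j hij]⟩
    · rw [LieSubalgebra.mem_engel_iff]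
      exact ⟨2, hH h⟩
  rw [h]
  exact LieSubalgebra.mem_top x

/-- A nonzero weight of the algebra. -/
def IsRoot (β : Module.Dual ℂ 𝔥) : Prop := β ≠ 0 ∧ ∃ x : L, x ≠ 0 ∧ D.IsWeight β x

/-- Local nilpotency gives a topmost vector y = e_i^p x of the i-string, primitive of sl₂-weight m +
2p. Then f_i^k y is nonzero for all k ≤ m + 2p, and one of these vectors has the reflected weight.
-/
theorem exists_isWeight_reflection_of_nonneg {β : Module.Dual ℂ 𝔥} (i : ι) {x : L} (hx0 : x ≠ 0)
    (hx : D.IsWeight β x) (m : ℕ) (hm : β (R.coroot i) = m) :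
    ∃ y : L, y ≠ 0 ∧ D.IsWeight (R.simpleRefl i β) y := by
  classical
  have hroot : R.root i (R.coroot i) = 2 := by rw [R.root_coroot, A.diag]; norm_num
  have hex := D.exists_ad_e_pow_eq_zero i x
  obtain ⟨p, hp⟩ : ∃ p, Nat.find hex = p + 1 := Nat.exists_eq_succ_of_ne_zero fun h => hx0 (by
    have := Nat.find_spec hex
    rwa [h, pow_zero, Module.End.one_apply] at this)
  set y := (ad ℂ L (D.e i) ^ p) x with hy
  have hy0 : y ≠ 0 := Nat.find_min hex (by omega)
  have hey : ⁅D.e i, y⁆ = 0 := by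
    have := Nat.find_spec hex
    rwa [hp, pow_succ', Module.End.mul_apply, ad_apply] at this
  have hyw : D.IsWeight (β + p • R.root i) y := hx.ad_e_pow i p
  have hHy : ⁅D.H (R.coroot i), y⁆ = ((m + 2 * p : ℕ) : ℂ) • y := by
    rw [hyw, LinearMap.add_apply, LinearMap.smul_apply, hroot, hm]
    push_cast
    rw [nsmul_eq_mul, mul_comm (p : ℂ)]
  have hne : ∀ k ≤ m + 2 * p, (ad ℂ L (D.f i) ^ k) y ≠ 0 := by
    intro k
    induction k with
    | zero => intro _; simpa using hy0
    | succ k ih =>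
      intro hk h0
      have h1 := D.lie_e_ad_f_pow i hey hHy k
      rw [h0, lie_zero] at h1
      refine smul_ne_zero ?_ (ih (by omega)) h1.symm
      refine mul_ne_zero (by exact_mod_cast Nat.succ_ne_zero k) (sub_ne_zero.2 ?_)
      exact_mod_cast (by omega : m + 2 * p ≠ k)
  -- Descending p steps returns to the weight β, and m more reach β − mα_i = s_i β.
  refine ⟨_, hne (p + m) (by omega), ?_⟩
  have h2 := hyw.ad_f_pow i (p + m)
  convert h2 using 1
  rw [R.simpleRefl_apply, hm, add_smul, Nat.cast_smul_eq_nsmul]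
  abel

theorem IsRoot.exists_word {β : Module.Dual ℂ 𝔥} (hβ : D.IsRoot β) :
    (∃ l, β = R.rootSum l ∧ D.word l ≠ 0) ∨ ∃ l, β = -R.rootSum l ∧ D.swap.word l ≠ 0 := by
  obtain ⟨h0, x, hx0, hx⟩ := hβ
  exact D.exists_word h0 hx0 hx

theorem rootSum_coroot (l : List ι) (i : ι) : ∃ m : ℤ, R.rootSum l (R.coroot i) = m := by
  induction l with
  | nil => exact ⟨0, by simp⟩
  | cons j l ih =>
    obtain ⟨m, hm⟩ := ih
    exact ⟨A.entry i j + m, by simp [R.root_coroot, hm]⟩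

theorem IsRoot.exists_int {β : Module.Dual ℂ 𝔥} (hβ : D.IsRoot β) (i : ι) :
    ∃ m : ℤ, β (R.coroot i) = m := by
  rcases IsRoot.exists_word D hβ with ⟨l, rfl, -⟩ | ⟨l, rfl, -⟩
  · exact rootSum_coroot l i
  · obtain ⟨m, hm⟩ := rootSum_coroot (R := R) l i
    exact ⟨-m, by simp [hm]⟩

/-- The set of roots is stable under simple reflections. -/
theorem IsRoot.simpleRefl {β : Module.Dual ℂ 𝔥} (hβ : D.IsRoot β) (i : ι) :
    D.IsRoot (R.simpleRefl i β) := by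
  refine ⟨(LinearEquiv.map_ne_zero_iff _).2 hβ.1, ?_⟩
  obtain ⟨m, hm⟩ := IsRoot.exists_int D hβ i
  obtain ⟨-, x, hx0, hx⟩ := hβ
  obtain ⟨n, rfl | rfl⟩ := m.eq_nat_or_neg
  · exact D.exists_isWeight_reflection_of_nonneg i hx0 hx n (by simpa using hm)
  · have hx' : D.swap.IsWeight (-β) x := D.toChevalleyData.isWeight_swap.2 (by rwa [neg_neg])
    obtain ⟨y, hy0, hy⟩ := D.swap.exists_isWeight_reflection_of_nonneg i hx0 hx' n (by simp [hm])
    refine ⟨y, hy0, ?_⟩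
    have := D.toChevalleyData.isWeight_swap.1 hy
    rwa [map_neg, neg_neg] at this

end SerreData
end

/-! ### Roots of the Kac–Moody algebra in lattice coordinates, and slices. -/

noncomputable section

open LieAlgebra

set_option linter.unusedSectionVars false

/-- The quotient map by an ideal, as a homomorphism of Lie algebras. -/
def LieIdeal.quotientHom {L : Type*} [LieRing L] [LieAlgebra ℂ L] (I : LieIdeal ℂ L) :
    L →ₗ⁅ℂ⁆ L ⧸ I :=
  { (LieSubmodule.Quotient.mk' I : L →ₗ[ℂ] L ⧸ I) with
    map_lie' := fun {x y} => LieSubmodule.Quotient.mk_bracket I x y }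

theorem LieIdeal.quotientHom_surjective {L : Type*} [LieRing L] [LieAlgebra ℂ L]
    (I : LieIdeal ℂ L) : Function.Surjective I.quotientHom :=
  LieSubmodule.Quotient.surjective_mk' I

theorem LieIdeal.quotientHom_eq_zero {L : Type*} [LieRing L] [LieAlgebra ℂ L]
    (I : LieIdeal ℂ L) {x : L} : I.quotientHom x = 0 ↔ x ∈ I :=
  LieSubmodule.Quotient.mk_eq_zero (N := I)

namespace Realization

variable {ι : Type*} [Fintype ι] {A : GCM ι} {𝔥 : Type*} [AddCommGroup 𝔥] [Module ℂ 𝔥]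
  (R : Realization A 𝔥)

/-- The generators of the algebra given by the Chevalley-Serre relations. -/
def preData : SerreData R R.PreKM :=
  have hrel {x : FreeLieAlgebra ℂ (Gen ι 𝔥)} (hx : R.Relator x) : R.relIdeal.quotientHom x = 0 :=
    (R.relIdeal.quotientHom_eq_zero).2 (LieSubmodule.subset_lieSpan hx)
  { e := fun i => R.relIdeal.quotientHom (freeE 𝔥 i)
    f := fun i => R.relIdeal.quotientHom (freeF 𝔥 i)
    H :=
      { toFun := fun h => R.relIdeal.quotientHom (freeH ι h)
        map_add' := fun h h' => by
          have := hrel (.add h h')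
          rwa [map_sub, map_add, sub_eq_zero] at this
        map_smul' := fun c h => by
          have := hrel (.smul c h)
          rwa [map_sub, map_smul, sub_eq_zero] at this }
    lie_H_H := fun h h' => by
      have := hrel (.hh h h')
      rwa [LieHom.map_lie] at this
    lie_H_e := fun h i => by
      have := hrel (.he h i)
      rwa [map_sub, map_smul, LieHom.map_lie, sub_eq_zero] at this
    lie_H_f := fun h i => by
      have := hrel (.hf h i)
      rwa [map_add, map_smul, LieHom.map_lie, add_eq_zero_iff_eq_neg] at this
    lie_e_f_same := fun i => by
      have := hrel (.ef_same i)
      rwa [map_sub, LieHom.map_lie, sub_eq_zero] at this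
    lie_e_f_ne := fun i j hij => by
      have := hrel (.ef_ne i j hij)
      rwa [LieHom.map_lie] at this
    serre_e := fun i j hij => by
      have := hrel (.serre_e i j hij)
      rwa [map_ad_pow] at this
    serre_f := fun i j hij => by
      have := hrel (.serre_f i j hij)
      rwa [map_ad_pow] at this
    generate := fun S he hf hH => by
      have h := FreeLieAlgebra.eq_top_of_forall_of_mem (S.comap R.relIdeal.quotientHom) (by
        rintro (i | i | h)
        · exact he i
        · exact hf i
        · exact hH h)
      refine eq_top_iff.2 fun y _ => ?_
      obtain ⟨x, rfl⟩ := R.relIdeal.quotientHom_surjective y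
      exact (h ▸ LieSubalgebra.mem_top x : x ∈ S.comap R.relIdeal.quotientHom) }

/-- The generators of the Kac-Moody algebra. -/
def kmData : SerreData R R.KM :=
  R.preData.map R.maxIdeal.quotientHom R.maxIdeal.quotientHom_surjective

theorem kmData_H (h : 𝔥) : R.kmData.H h = R.cartan h := rfl

/-- Each ideal in the defining sum lies in the sum of the two nilpotent parts, hence so does their
sum; thus the largest ideal still meets 𝔥 trivially. -/
theorem eq_zero_of_preCartan_mem {h : 𝔥} (hh : R.preCartan h ∈ R.maxIdeal) : h = 0 := by
  have hle : R.maxIdeal.toSubmodule ≤ R.preData.wordSpan ⊔ R.preData.swap.wordSpan := by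
    rw [maxIdeal, LieSubmodule.sSup_toSubmodule]
    refine sSup_le ?_
    rintro _ ⟨I, hI, rfl⟩
    exact R.preData.ideal_le_wordSpan I hI
  exact R.preCartan_eq_zero (R.preData.H_eq_zero_of_mem_wordSpan (hle hh))

theorem cartan_eq_zero {h : 𝔥} (hh : R.cartan h = 0) : h = 0 :=
  R.eq_zero_of_preCartan_mem ((R.maxIdeal.quotientHom_eq_zero).1 hh)

/-- Every nonzero ideal of the Kac-Moody algebra meets the Cartan subalgebra. -/
theorem ideal_eq_bot (I : LieIdeal ℂ R.KM) (hI : ∀ h, R.cartan h ∈ I → h = 0) : I = ⊥ := by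
  have hle : I.comap R.maxIdeal.quotientHom ≤ R.maxIdeal := by
    refine le_sSup fun h hh => ?_
    rw [hI h (LieIdeal.mem_comap.1 hh)]
    exact R.preData.H.map_zero
  refine (LieSubmodule.eq_bot_iff I).2 fun y hy => ?_
  obtain ⟨x, rfl⟩ := R.maxIdeal.quotientHom_surjective y
  exact (R.maxIdeal.quotientHom_eq_zero).2 (hle (LieIdeal.mem_comap.2 hy))

/-! ### Integral combinations of simple roots -/

/-- The element of the root lattice with given coordinates. -/
def ofInt (c : ι → ℤ) : Module.Dual ℂ 𝔥 := ∑ i, (c i : ℂ) • R.root i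

theorem ofInt_injective : Function.Injective R.ofInt := by
  intro c d h
  have := R.sum_root_injective h
  funext i
  exact_mod_cast congrFun this i

theorem coeff_ofInt (c : ι → ℤ) (i : ι) : R.coeff (R.ofInt c) i = c i :=
  congrFun (R.coeff_sum _) i

theorem ofInt_sub (c d : ι → ℤ) : R.ofInt (c - d) = R.ofInt c - R.ofInt d := by
  simp [ofInt, sub_smul]

theorem ofInt_neg (c : ι → ℤ) : R.ofInt (-c) = -R.ofInt c := by
  simp [ofInt]

theorem ofInt_zero : R.ofInt 0 = 0 := by simp [ofInt]

theorem ofInt_single [DecidableEq ι] (i : ι) (m : ℤ) :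
    R.ofInt (Pi.single i m) = (m : ℂ) • R.root i := by
  rw [ofInt, Finset.sum_eq_single i]
  · simp
  · intro j _ hj; simp [hj]
  · simp

theorem ofInt_coroot (c : ι → ℤ) (j : ι) :
    R.ofInt c (R.coroot j) = ((A.entry.mulVec c j : ℤ) : ℂ) := by
  simp [ofInt, LinearMap.sum_apply, R.root_coroot, Matrix.mulVec, dotProduct, mul_comm]

theorem simpleRefl_ofInt [DecidableEq ι] (c : ι → ℤ) (j : ι) :
    R.simpleRefl j (R.ofInt c) = R.ofInt (c - Pi.single j (A.entry.mulVec c j)) := by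
  rw [simpleRefl_apply, ofInt_sub, ofInt_single, ofInt_coroot]

theorem simpleRefl_simpleRefl (j : ι) (μ : Module.Dual ℂ 𝔥) :
    R.simpleRefl j (R.simpleRefl j μ) = μ :=
  Module.involutive_reflection _ μ

theorem rootSum_eq_ofInt [DecidableEq ι] (l : List ι) :
    R.rootSum l = R.ofInt fun i => (l.count i : ℤ) := by
  rw [rootSum_eq]; simp [ofInt]

theorem ofInt_natCast (c : ι → ℕ) : ∑ i, c i • R.root i = R.ofInt fun i => (c i : ℤ) := by
  simp [ofInt, Nat.cast_smul_eq_nsmul]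

end Realization

namespace SerreData

variable {ι : Type*} [Fintype ι] {A : GCM ι} {𝔥 : Type*} [AddCommGroup 𝔥] [Module ℂ 𝔥]
  {R : Realization A 𝔥} {L : Type*} [LieRing L] [LieAlgebra ℂ L] (D : SerreData R L)

/-- A root with a positive coordinate is the weight of a nonvanishing word. -/
theorem exists_word_of_pos {c : ι → ℤ} (hc : D.IsRoot (R.ofInt c)) {i : ι} (hi : 0 < c i) :
    ∃ l, R.ofInt c = R.rootSum l ∧ D.word l ≠ 0 := by
  classical
  rcases SerreData.IsRoot.exists_word D hc with h | ⟨l, hl, -⟩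
  · exact h
  · rw [R.rootSum_eq_ofInt, ← R.ofInt_neg] at hl
    have := congrFun (R.ofInt_injective hl) i
    simp only [Pi.neg_apply] at this
    omega

theorem nonneg_of_pos {c : ι → ℤ} (hc : D.IsRoot (R.ofInt c)) {i : ι} (hi : 0 < c i) :
    0 ≤ c := by
  classical
  obtain ⟨l, hl, -⟩ := D.exists_word_of_pos hc hi
  rw [R.rootSum_eq_ofInt] at hl
  rw [R.ofInt_injective hl]
  exact fun i => Int.natCast_nonneg _

theorem exists_pos_of_nonneg {c : ι → ℤ} (hc : D.IsRoot (R.ofInt c)) (h0 : 0 ≤ c) :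
    ∃ i, 0 < c i := by
  by_contra! h
  exact hc.1 (by rw [le_antisymm h h0, R.ofInt_zero])

theorem isRoot_sub_single [DecidableEq ι] {c : ι → ℤ} (hc : D.IsRoot (R.ofInt c)) (i : ι) :
    D.IsRoot (R.ofInt (c - Pi.single i (A.entry.mulVec c i))) := by
  have h := SerreData.IsRoot.simpleRefl D hc i
  rwa [R.simpleRefl_ofInt] at h

/-- A positive root that is a multiple of a simple root is that simple root. -/
theorem eq_single_of_support [DecidableEq ι] {c : ι → ℤ} (hc : D.IsRoot (R.ofInt c))
    {i : ι} (hi : 0 < c i) {j : ι} (hsupp : ∀ i, c i ≠ 0 → i = j) : c = Pi.single j 1 := by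
  obtain ⟨l, hl, hl'⟩ := D.exists_word_of_pos hc hi
  rw [R.rootSum_eq_ofInt] at hl
  have hcl := R.ofInt_injective hl
  have hmem : ∀ i ∈ l, i = j := fun i hi => hsupp i (by
    rw [hcl]; simpa [List.count_eq_zero] using hi)
  have hlen : l.length = 1 := by
    by_contra h
    exact hl' (D.word_eq_zero_of_forall_eq hmem h)
  obtain ⟨k, rfl⟩ := List.length_eq_one_iff.1 hlen
  obtain rfl : k = j := hmem k (by simp)
  rw [hcl]
  funext m
  by_cases hm : m = k
  · subst hm; simp
  · simp [hm, Ne.symm hm]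

theorem isRoot_of_word_ne_zero {l : List ι} (hl : D.word l ≠ 0) : D.IsRoot (R.rootSum l) :=
  ⟨R.rootSum_ne_zero (by rintro rfl; exact hl rfl), _, hl, D.isWeight_word l⟩

end SerreData

namespace Realization

variable {ι : Type*} [Fintype ι] {A : GCM ι} {𝔥 : Type*} [AddCommGroup 𝔥] [Module ℂ 𝔥]
  (R : Realization A 𝔥)

theorem rootSum_mem_posRoots {l : List ι} (hl : R.kmData.word l ≠ 0) :
    R.rootSum l ∈ R.posRoots := by
  classical
  exact ⟨R.kmData.isRoot_of_word_ne_zero hl, fun i => l.count i, by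
    rw [ofInt_natCast, rootSum_eq_ofInt]⟩

theorem mem_posRoots_of_pos {c : ι → ℤ} (hc : R.ofInt c ∈ R.roots) {i : ι} (hi : 0 < c i) :
    R.ofInt c ∈ R.posRoots := by
  obtain ⟨l, hl, hl'⟩ := R.kmData.exists_word_of_pos hc hi
  rw [hl]
  exact R.rootSum_mem_posRoots hl'

theorem nonneg_of_mem_posRoots {c : ι → ℤ} (hc : R.ofInt c ∈ R.posRoots) : 0 ≤ c := by
  obtain ⟨-, d, hd⟩ := hc
  rw [ofInt_natCast] at hd
  rw [R.ofInt_injective hd]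
  exact fun i => Int.natCast_nonneg _

theorem exists_pos_of_mem_posRoots {c : ι → ℤ} (hc : R.ofInt c ∈ R.posRoots) : ∃ i, 0 < c i := by
  by_contra! h
  have h0 : c = 0 := le_antisymm h (R.nonneg_of_mem_posRoots hc)
  exact hc.1.1 (by rw [h0, ofInt_zero])

theorem exists_ofInt_of_mem_posRoots {β : Module.Dual ℂ 𝔥} (hβ : β ∈ R.posRoots) :
    ∃ c, β = R.ofInt c := by
  obtain ⟨-, d, hd⟩ := hβ
  exact ⟨_, by rw [hd, ofInt_natCast]⟩

theorem exists_ofInt_of_mem_roots {β : Module.Dual ℂ 𝔥} (hβ : β ∈ R.roots) :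
    ∃ c, β = R.ofInt c ∧ (0 ≤ c ∨ c ≤ 0) := by
  classical
  rcases SerreData.IsRoot.exists_word R.kmData hβ with ⟨l, rfl, -⟩ | ⟨l, rfl, -⟩
  · exact ⟨_, R.rootSum_eq_ofInt l, Or.inl fun i => Int.natCast_nonneg _⟩
  · refine ⟨_, by rw [R.rootSum_eq_ofInt l, ← ofInt_neg], Or.inr fun i => ?_⟩
    simp

theorem simpleRefl_mem_roots {β : Module.Dual ℂ 𝔥} (hβ : β ∈ R.roots) (i : ι) :
    R.simpleRefl i β ∈ R.roots :=
  SerreData.IsRoot.simpleRefl R.kmData hβ i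

/-- s_i alters only the i-th coordinate, so the positive coordinate at k survives, and one positive
coordinate makes a root positive. -/
theorem simpleRefl_mem_posRoots [DecidableEq ι] {c : ι → ℤ} (hc : R.ofInt c ∈ R.posRoots)
    {i k : ι} (hki : k ≠ i) (hk : 0 < c k) :
    R.ofInt (c - Pi.single i (A.entry.mulVec c i)) ∈ R.posRoots := by
  have h := R.simpleRefl_mem_roots hc.1 i
  rw [simpleRefl_ofInt] at h
  exact R.mem_posRoots_of_pos (i := k) h (by simpa [hki] using hk)

/-- Otherwise α_i^∨ = [e_i, f_i] would vanish in 𝔤(A), although 𝔥 embeds. -/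
theorem kmData_e_ne_zero (i : ι) : R.kmData.e i ≠ 0 := by
  intro h
  have h1 := R.kmData.lie_e_f_same i
  rw [h, zero_lie] at h1
  exact R.coroot_linearIndependent.ne_zero i (R.cartan_eq_zero h1.symm)

theorem root_mem_posRoots (i : ι) : R.root i ∈ R.posRoots := by
  simpa using R.rootSum_mem_posRoots (l := [i]) (R.kmData_e_ne_zero i)

theorem root_eq_ofInt [DecidableEq ι] (i : ι) : R.root i = R.ofInt (Pi.single i 1) := by
  rw [ofInt_single]; simp

theorem lie_e_e_eq_zero {i j : ι} (h : A.entry i j = 0) : ⁅R.kmData.e i, R.kmData.e j⁆ = 0 := by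
  have hij : i ≠ j := by
    rintro rfl
    rw [A.diag] at h
    exact absurd h (by norm_num)
  simpa [h] using R.kmData.serre_e i j hij

/-- The support of a positive root does not split into two orthogonal parts. -/
theorem support_connected {c : ι → ℤ} (hc : R.ofInt c ∈ R.posRoots) {S T : Set ι}
    (hST : ∀ s ∈ S, ∀ t ∈ T, A.entry s t = 0) (hsupp : ∀ i, c i ≠ 0 → i ∈ S ∨ i ∈ T) :
    (∀ i, c i ≠ 0 → i ∈ S) ∨ (∀ i, c i ≠ 0 → i ∈ T) := by
  classical
  obtain ⟨i, hi⟩ := R.exists_pos_of_mem_posRoots hc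
  obtain ⟨l, hl, hl'⟩ := R.kmData.exists_word_of_pos hc.1 hi
  rw [rootSum_eq_ofInt] at hl
  have hcl : ∀ i, c i ≠ 0 ↔ i ∈ l := fun i => by
    rw [R.ofInt_injective hl]; simp [List.count_eq_zero]
  simp only [hcl] at hsupp ⊢
  exact (R.kmData.word_mixed (fun s hs t ht => R.lie_e_e_eq_zero (hST s hs t ht)) l
    hsupp).resolve_left hl'

/-! ### Slices of the root system -/

theorem mem_slice_iff {a b : ι → ℤ} {J : Set ι} :
    R.ofInt b ∈ R.slice (R.ofInt a) J ↔ R.ofInt b ∈ R.posRoots ∧ ∀ i ∉ J, b i = a i := by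
  refine and_congr_right fun _ => ?_
  rw [← ofInt_sub]
  simp only [supp, coeff_ofInt, Set.subset_def, Set.mem_ofPred_eq]
  refine forall_congr' fun i => ?_
  rw [not_imp_comm]
  simp [sub_eq_zero]

theorem exists_ofInt_of_mem_slice {a : ι → ℤ} {J : Set ι} {β : Module.Dual ℂ 𝔥}
    (hβ : β ∈ R.slice (R.ofInt a) J) :
    ∃ b, β = R.ofInt b ∧ R.ofInt b ∈ R.posRoots ∧ ∀ i ∉ J, b i = a i := by
  obtain ⟨b, rfl⟩ := R.exists_ofInt_of_mem_posRoots hβ.1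
  exact ⟨b, rfl, R.mem_slice_iff.1 hβ⟩

theorem self_mem_slice {α : Module.Dual ℂ 𝔥} (hα : α ∈ R.posRoots) (J : Set ι) :
    α ∈ R.slice α J := by
  obtain ⟨a, rfl⟩ := R.exists_ofInt_of_mem_posRoots hα
  exact R.mem_slice_iff.2 ⟨hα, fun _ _ => rfl⟩

theorem slice_mono (α : Module.Dual ℂ 𝔥) {J K : Set ι} (h : J ⊆ K) :
    R.slice α J ⊆ R.slice α K :=
  fun _ hβ => ⟨hβ.1, hβ.2.trans h⟩

theorem slice_empty {α : Module.Dual ℂ 𝔥} (hα : α ∈ R.posRoots) : R.slice α ∅ = {α} := by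
  obtain ⟨a, rfl⟩ := R.exists_ofInt_of_mem_posRoots hα
  refine Set.Subset.antisymm (fun β hβ => ?_) (by simpa using R.self_mem_slice hα ∅)
  obtain ⟨b, rfl, -, hb⟩ := R.exists_ofInt_of_mem_slice hβ
  rw [Set.mem_singleton_iff, funext fun i => hb i (Set.notMem_empty i)]

theorem supp_compl {a : ι → ℤ} {J : Set ι} :
    J ⊆ (R.supp (R.ofInt a))ᶜ ↔ ∀ j ∈ J, a j = 0 := by
  simp [supp, coeff_ofInt, Set.subset_def]

/-- Some positive coordinate of α lies outside J, where every member of the slice agrees with α and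
s_j changes nothing. -/
theorem slice_simpleRefl {a b : ι → ℤ} {J : Set ι} (ha : R.ofInt a ∈ R.posRoots)
    (hJ : ∀ j ∈ J, a j = 0) [DecidableEq ι] (hb : R.ofInt b ∈ R.posRoots)
    (hbJ : ∀ i ∉ J, b i = a i) {j : ι} (hj : j ∈ J) :
    R.ofInt (b - Pi.single j (A.entry.mulVec b j)) ∈ R.posRoots ∧
      ∀ i ∉ J, (b - Pi.single j (A.entry.mulVec b j) : ι → ℤ) i = a i := by
  obtain ⟨k, hk⟩ := R.exists_pos_of_mem_posRoots ha
  have hkJ : k ∉ J := fun h => by have := hJ k h; omega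
  refine ⟨R.simpleRefl_mem_posRoots (k := k) hb ?_ (by rw [hbJ k hkJ]; exact hk), fun i hi => ?_⟩
  · rintro rfl; exact hkJ hj
  · have : i ≠ j := by rintro rfl; exact hi hj
    simpa [this] using hbJ i hi

theorem simpleRefl_mem_slice {α β : Module.Dual ℂ 𝔥} {J : Set ι} (hα : α ∈ R.posRoots)
    (hJ : J ⊆ (R.supp α)ᶜ) (hβ : β ∈ R.slice α J) {j : ι} (hj : j ∈ J) :
    R.simpleRefl j β ∈ R.slice α J := by
  classical
  obtain ⟨a, rfl⟩ := R.exists_ofInt_of_mem_posRoots hα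
  obtain ⟨b, rfl, hb, hbJ⟩ := R.exists_ofInt_of_mem_slice hβ
  rw [simpleRefl_ofInt, mem_slice_iff]
  exact R.slice_simpleRefl hα (R.supp_compl.1 hJ) hb hbJ hj

/-- A set stable under the simple reflections is stable under the parabolic subgroup. -/
theorem parabolic_mem_of_stable {J : Set ι} {X : Set (Module.Dual ℂ 𝔥)}
    (hX : ∀ j ∈ J, ∀ μ ∈ X, R.simpleRefl j μ ∈ X) {w : Module.Dual ℂ 𝔥 ≃ₗ[ℂ] Module.Dual ℂ 𝔥}
    (hw : w ∈ R.parabolic J) {μ : Module.Dual ℂ 𝔥} (hμ : μ ∈ X) : w μ ∈ X := by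
  induction hw using Subgroup.closure_induction_left generalizing μ with
  | one => exact hμ
  | mul_left s hs w _ ih =>
    obtain ⟨j, hj, rfl⟩ := hs
    exact hX j hj _ (ih hμ)
  | inv_mul_cancel s hs w _ ih =>
    obtain ⟨j, hj, rfl⟩ := hs
    have h : (R.simpleRefl j)⁻¹ (w μ) = R.simpleRefl j (w μ) := by
      rw [← R.simpleRefl_simpleRefl j (w μ)]
      conv_rhs => rw [R.simpleRefl_simpleRefl]
      exact (R.simpleRefl j).symm_apply_apply _
    rw [LinearEquiv.mul_apply, h]
    exact hX j hj _ (ih hμ)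

theorem simpleRefl_mem_parabolic {J : Set ι} {j : ι} (hj : j ∈ J) :
    R.simpleRefl j ∈ R.parabolic J :=
  Subgroup.subset_closure ⟨j, hj, rfl⟩

theorem simpleRefl_mem_orbit {J : Set ι} {S : Set (Module.Dual ℂ 𝔥)} {μ : Module.Dual ℂ 𝔥}
    (hμ : μ ∈ R.orbit J S) {j : ι} (hj : j ∈ J) : R.simpleRefl j μ ∈ R.orbit J S := by
  obtain ⟨w, hw, ν, hν, rfl⟩ := hμ
  exact ⟨R.simpleRefl j * w, mul_mem (R.simpleRefl_mem_parabolic hj) hw, ν, hν, rfl⟩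

theorem subset_orbit (J : Set ι) (S : Set (Module.Dual ℂ 𝔥)) : S ⊆ R.orbit J S :=
  fun μ hμ => ⟨1, one_mem _, μ, hμ, rfl⟩

theorem orbit_subset_slice {α : Module.Dual ℂ 𝔥} {J : Set ι} (hα : α ∈ R.posRoots)
    (hJ : J ⊆ (R.supp α)ᶜ) : R.orbit J {α} ⊆ R.slice α J := by
  rintro _ ⟨w, hw, ν, rfl, rfl⟩
  exact R.parabolic_mem_of_stable (fun j hj μ hμ => R.simpleRefl_mem_slice hα hJ hμ hj) hw
    (R.self_mem_slice hα J)

end Realization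
end

/-! ### Finite type: bounded lattice points, slices, parabolic subgroups and roots. -/

noncomputable section

set_option linter.unusedSectionVars false

namespace GCM

variable {ι : Type*} [Fintype ι] (A : GCM ι)

/-- The bilinear form with matrix `d_i a_{ij}`. -/
def form (d x y : ι → ℝ) : ℝ := ∑ i, d i * x i * ∑ j, (A.entry i j : ℝ) * y j

/-- `A_{J × J}` is symmetrizable with positive definite symmetrization. -/
def FiniteTypeOn (J : Set ι) : Prop :=
  ∃ d : ι → ℝ, (∀ i, 0 < d i) ∧
    (∀ i ∈ J, ∀ j ∈ J, d i * A.entry i j = d j * A.entry j i) ∧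
    ∀ x : ι → ℝ, (∀ i ∉ J, x i = 0) → x ≠ 0 → 0 < A.form d x x

variable {A}

theorem form_sub_left (d x x' y : ι → ℝ) :
    A.form d (x - x') y = A.form d x y - A.form d x' y := by
  simp [form, mul_sub, sub_mul, Finset.sum_sub_distrib]

theorem form_sub_right (d x y y' : ι → ℝ) :
    A.form d x (y - y') = A.form d x y - A.form d x y' := by
  simp [form, mul_sub, Finset.sum_sub_distrib]

theorem form_smul_left (d x y : ι → ℝ) (t : ℝ) : A.form d (t • x) y = t * A.form d x y := by
  simp only [form, Pi.smul_apply, smul_eq_mul, Finset.mul_sum (a := t)]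
  exact Finset.sum_congr rfl fun i _ => by ring

theorem form_smul_right (d x y : ι → ℝ) (t : ℝ) : A.form d x (t • y) = t * A.form d x y := by
  simp only [form, Pi.smul_apply, smul_eq_mul, Finset.mul_sum]
  exact Finset.sum_congr rfl fun i _ => Finset.sum_congr rfl fun j _ => by ring

theorem form_single_left [DecidableEq ι] (d y : ι → ℝ) (j : ι) :
    A.form d (Pi.single j 1) y = d j * ∑ k, (A.entry j k : ℝ) * y k := by
  rw [form, Finset.sum_eq_single j]
  · simp
  · intro i _ hi; simp [hi]
  · simp

theorem form_single_right [DecidableEq ι] {d : ι → ℝ} {J : Set ι}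
    (hsymm : ∀ i ∈ J, ∀ j ∈ J, d i * A.entry i j = d j * A.entry j i) {x : ι → ℝ}
    (hx : ∀ i ∉ J, x i = 0) {j : ι} (hj : j ∈ J) :
    A.form d x (Pi.single j 1) = d j * ∑ k, (A.entry j k : ℝ) * x k := by
  rw [form, Finset.mul_sum]
  refine Finset.sum_congr rfl fun i _ => ?_
  by_cases hi : i ∈ J
  · have := hsymm i hi j hj
    simp only [Pi.single_apply, mul_ite, mul_one, mul_zero, Finset.sum_ite_eq', Finset.mem_univ,
      if_true]
    linear_combination x i * this
  · simp [hx i hi]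

/-- Behaviour of the quadratic form under translation by a multiple of a simple root. -/
theorem form_sub_single [DecidableEq ι] {d : ι → ℝ} {J : Set ι}
    (hsymm : ∀ i ∈ J, ∀ j ∈ J, d i * A.entry i j = d j * A.entry j i) {x : ι → ℝ}
    (hx : ∀ i ∉ J, x i = 0) {j : ι} (hj : j ∈ J) (t : ℝ) :
    A.form d (x - t • Pi.single j 1) (x - t • Pi.single j 1) =
      A.form d x x - 2 * t * d j * ∑ k, (A.entry j k : ℝ) * x k + 2 * d j * t ^ 2 := by
  have h2 : ∑ k, (A.entry j k : ℝ) * (Pi.single j 1 : ι → ℝ) k = 2 := by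
    simp [Pi.single_apply, A.diag]
  simp only [form_sub_left, form_sub_right, form_smul_left, form_smul_right, form_single_left,
    form_single_right hsymm hx hj, h2]
  ring

theorem continuous_form (d : ι → ℝ) : Continuous fun x : ι → ℝ => A.form d x x := by
  unfold form
  fun_prop

/-- The constant is the minimum of the form on the compact unit sphere of the coordinate subspace;
homogeneity does the rest. -/
theorem exists_mul_norm_sq_le {d : ι → ℝ} {J : Set ι}
    (hpos : ∀ x : ι → ℝ, (∀ i ∉ J, x i = 0) → x ≠ 0 → 0 < A.form d x x) :
    ∃ m : ℝ, 0 < m ∧ ∀ x : ι → ℝ, (∀ i ∉ J, x i = 0) → m * ‖x‖ ^ 2 ≤ A.form d x x := by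
  let T : Set (ι → ℝ) := {x | ∀ i ∉ J, x i = 0}
  have hT : IsClosed T := by
    have : T = ⋂ i, ⋂ _ : i ∉ J, {x | x i = 0} := by ext x; simp [T]
    rw [this]
    exact isClosed_iInter fun i => isClosed_iInter fun _ =>
      isClosed_eq (continuous_apply i) continuous_const
  have hS : IsCompact (Metric.sphere (0 : ι → ℝ) 1 ∩ T) := (isCompact_sphere 0 1).inter_right hT
  have hscale : ∀ x : ι → ℝ, x ∈ T → x ≠ 0 → ‖x‖⁻¹ • x ∈ Metric.sphere (0 : ι → ℝ) 1 ∩ T := by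
    intro x hx h0
    refine ⟨?_, fun i hi => by simp [hx i hi]⟩
    rw [mem_sphere_zero_iff_norm, norm_smul, norm_inv, norm_norm,
      inv_mul_cancel₀ (norm_ne_zero_iff.2 h0)]
  rcases Set.eq_empty_or_nonempty (Metric.sphere (0 : ι → ℝ) 1 ∩ T) with hemp | hne
  · refine ⟨1, one_pos, fun x hx => ?_⟩
    by_cases h0 : x = 0
    · subst h0; simp [form]
    · exact absurd (hscale x hx h0) (by rw [hemp]; simp)
  · obtain ⟨y, ⟨hy1, hyT⟩, hy⟩ := hS.exists_isMinOn hne (A.continuous_form d).continuousOn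
    have hy0 : y ≠ 0 := by
      rintro rfl
      simp at hy1
    refine ⟨_, hpos y hyT hy0, fun x hx => ?_⟩
    by_cases h0 : x = 0
    · subst h0; simp [form]
    · have h1 := isMinOn_iff.1 hy _ (hscale x hx h0)
      rw [form_smul_left, form_smul_right] at h1
      have hn : 0 < ‖x‖ := norm_pos_iff.2 h0
      calc A.form d y y * ‖x‖ ^ 2
          ≤ ‖x‖⁻¹ * (‖x‖⁻¹ * A.form d x x) * ‖x‖ ^ 2 := by gcongr
        _ = A.form d x x := by field_simp

theorem finite_of_form_le {d : ι → ℝ} {J : Set ι}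
    (hpos : ∀ x : ι → ℝ, (∀ i ∉ J, x i = 0) → x ≠ 0 → 0 < A.form d x x) {K : ℝ} (hK : 0 ≤ K) :
    {c : ι → ℤ | (∀ i ∉ J, c i = 0) ∧ A.form d (fun i => (c i : ℝ)) (fun i => (c i : ℝ)) ≤
      K * (1 + ‖fun i => (c i : ℝ)‖)}.Finite := by
  classical
  obtain ⟨m, hm, hle⟩ := exists_mul_norm_sq_le hpos
  -- Beyond norm 1 one has K(1 + ‖x‖) ≤ 2K‖x‖, and beyond 2K/m this is less than m‖x‖².
  let B : ℝ := max 1 (2 * K / m)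
  refine (Set.finite_Icc (fun _ => -⌈B⌉ : ι → ℤ) (fun _ => ⌈B⌉)).subset ?_
  rintro c ⟨hcJ, hc⟩
  set x : ι → ℝ := fun i => (c i : ℝ) with hx
  have h1 := hle x fun i hi => by simp [hx, hcJ i hi]
  have hB : ‖x‖ ≤ B := by
    by_contra! h
    obtain ⟨hB1, hB2⟩ := max_lt_iff.1 h
    rw [div_lt_iff₀ hm] at hB2
    nlinarith
  have hi : ∀ i, |c i| ≤ ⌈B⌉ := fun i => by
    have h2 : |(c i : ℝ)| ≤ B := by
      simpa [hx] using (norm_le_pi_norm x i).trans hB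
    exact_mod_cast h2.trans (Int.le_ceil B)
  exact ⟨fun i => (abs_le.1 (hi i)).1, fun i => (abs_le.1 (hi i)).2⟩

theorem mulVec_cast (c : ι → ℤ) (j : ι) :
    ∑ k, (A.entry j k : ℝ) * (c k : ℝ) = ((A.entry.mulVec c j : ℤ) : ℝ) := by
  simp [Matrix.mulVec, dotProduct]

theorem cast_sub_single [DecidableEq ι] (c : ι → ℤ) (j : ι) (t : ℤ) :
    (fun i => ((c - Pi.single j t : ι → ℤ) i : ℝ)) =
      (fun i => (c i : ℝ)) - (t : ℝ) • (Pi.single j 1 : ι → ℝ) := by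
  funext i
  by_cases h : i = j
  · subst h; simp
  · simp [h]

open Classical in
/-- A nonsingular integral matrix extending `A_{J × J}`. -/
def extendMatrix (A : GCM ι) (J : Set ι) : Matrix ι ι ℤ :=
  Matrix.of fun i j => if i ∈ J ∧ j ∈ J then A.entry i j else if i = j then 1 else 0

/-- The identity block forces a kernel vector to be supported in J, where it would be isotropic for
the positive definite form. -/
theorem det_extendMatrix_ne_zero {J : Set ι} (h : A.FiniteTypeOn J) [DecidableEq ι] :
    (A.extendMatrix J).det ≠ 0 := by
  classical
  obtain ⟨d, -, -, hpos⟩ := h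
  intro h0
  have h1 : ((A.extendMatrix J).map (Int.castRingHom ℝ)).det = 0 := by
    rw [← RingHom.mapMatrix_apply, ← RingHom.map_det, h0, map_zero]
  obtain ⟨x, hx0, hx⟩ := Matrix.exists_mulVec_eq_zero_iff.2 h1
  have hrow : ∀ i, ∑ j, ((A.extendMatrix J i j : ℤ) : ℝ) * x j = 0 := fun i => by
    simpa [Matrix.mulVec, dotProduct] using congrFun hx i
  have hxJ : ∀ i ∉ J, x i = 0 := fun i hi => by
    simpa [extendMatrix, hi, ite_mul] using hrow i
  refine (hpos x hxJ hx0).ne' (Finset.sum_eq_zero fun i _ => ?_)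
  by_cases hi : i ∈ J
  · rw [← mul_zero (d i * x i), ← hrow i]
    congr 1
    refine Finset.sum_congr rfl fun j _ => ?_
    by_cases hj : j ∈ J
    · simp [extendMatrix, hi, hj]
    · simp [hxJ j hj]
  · simp [hxJ i hi]

/-- Linear systems with a coefficient matrix of finite type are solvable. -/
theorem FiniteTypeOn.exists_solution {J : Set ι} (h : A.FiniteTypeOn J) (b : ι → ℂ) :
    ∃ c : ι → ℂ, (∀ i ∉ J, c i = 0) ∧ ∀ i ∈ J, ∑ j, (A.entry i j : ℂ) * c j = b i := by
  classical
  let M : Matrix ι ι ℂ := (A.extendMatrix J).map (Int.castRingHom ℂ)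
  have hM : IsUnit M.det := by
    have hdet : M.det = Int.castRingHom ℂ (A.extendMatrix J).det :=
      (RingHom.map_det (Int.castRingHom ℂ) (A.extendMatrix J)).symm
    rw [isUnit_iff_ne_zero, hdet]
    simpa using det_extendMatrix_ne_zero h
  let b' : ι → ℂ := fun i => if i ∈ J then b i else 0
  have hc : M.mulVec (M⁻¹.mulVec b') = b' := by
    rw [Matrix.mulVec_mulVec, Matrix.mul_nonsing_inv _ hM, Matrix.one_mulVec]
  have hrow : ∀ i, ∑ j, ((A.extendMatrix J i j : ℤ) : ℂ) * M⁻¹.mulVec b' j = b' i := fun i => by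
    have := congrFun hc i
    rw [Matrix.mulVec, dotProduct] at this
    simpa [M] using this
  have hJ : ∀ i ∉ J, M⁻¹.mulVec b' i = 0 := fun i hi => by
    simpa [extendMatrix, hi, ite_mul, b'] using hrow i
  refine ⟨M⁻¹.mulVec b', hJ, fun i hi => ?_⟩
  have hb : b' i = b i := if_pos hi
  rw [← hb, ← hrow i]
  refine Finset.sum_congr rfl fun j _ => ?_
  by_cases hj : j ∈ J
  · simp [extendMatrix, hi, hj]
  · simp [hJ j hj]

theorem finiteTypeOn_singleton (j : ι) : A.FiniteTypeOn {j} := by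
  classical
  refine ⟨fun _ => 1, fun _ => one_pos, ?_, fun x hx h0 => ?_⟩
  · rintro i rfl k rfl; rfl
  · have hxj : x = x j • Pi.single j 1 := by
      funext i
      by_cases hi : i = j
      · subst hi; simp
      · simp [hi, hx i hi]
    have hj : x j ≠ 0 := fun h => h0 (by rw [hxj, h, zero_smul])
    rw [hxj, form_smul_left, form_smul_right, form_single_left]
    have h2 : ∑ k, (A.entry j k : ℝ) * (Pi.single j 1 : ι → ℝ) k = 2 := by
      simp [Pi.single_apply, A.diag]
    rw [h2]
    have := mul_self_pos.2 hj
    linarith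

theorem sum_entry_nonpos {a : ι → ℤ} (ha : 0 ≤ a) {j : ι} (hj : a j = 0) :
    A.entry.mulVec a j ≤ 0 := by
  refine Finset.sum_nonpos fun i _ => ?_
  by_cases hij : j = i
  · subst hij; rw [hj, mul_zero]
  · exact mul_nonpos_of_nonpos_of_nonneg (A.nonpos j i hij) (ha i)

end GCM

namespace Realization

open GCM

variable {ι : Type*} [Fintype ι] {A : GCM ι} {𝔥 : Type*} [AddCommGroup 𝔥] [Module ℂ 𝔥]
  (R : Realization A 𝔥)

theorem slice_finite {α : Module.Dual ℂ 𝔥} (hα : α ∈ R.posRoots) {J : Set ι}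
    (hJ : J ⊆ (R.supp α)ᶜ) (hfin : A.FiniteTypeOn J) : (R.slice α J).Finite := by
  classical
  obtain ⟨a, rfl⟩ := R.exists_ofInt_of_mem_posRoots hα
  rw [R.supp_compl] at hJ
  obtain ⟨d, hd, hsymm, hpos⟩ := hfin
  let p : ι → ℝ := fun i => ((A.entry.mulVec a i : ℤ) : ℝ)
  have hp : ∀ j ∈ J, p j ≤ 0 := fun j hj => by
    exact Int.cast_nonpos.2 (sum_entry_nonpos (R.nonneg_of_mem_posRoots hα) (hJ j hj))
  -- At x = β − α this is formally (β,β) − (α,α). Only pairings with the coroots of J matter, so no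
  -- symmetrization outside J is required.
  let Q : (ι → ℝ) → ℝ := fun x => A.form d x x + 2 * ∑ i, d i * p i * x i
  have hQ : ∀ (n : ℕ) (b : ι → ℤ), R.ofInt b ∈ R.posRoots → (∀ i ∉ J, b i = a i) →
      (∑ i, b i).toNat = n → Q (fun i => ((b - a) i : ℝ)) ≤ 0 := by
    intro n
    induction n using Nat.strong_induction_on with
    | _ n ih =>
      intro b hb hbJ hn
      have hb0 := R.nonneg_of_mem_posRoots hb
      have hsuppI : ∀ i ∉ J, (b - a) i = 0 := fun i hi => by simp [hbJ i hi]
      have hsupp : ∀ i ∉ J, ((b - a) i : ℝ) = 0 := fun i hi => by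
        exact_mod_cast hsuppI i hi
      have hsum : ∀ j, ∑ k, (A.entry j k : ℝ) * ((b - a) k : ℝ) + p j =
          ((A.entry.mulVec b j : ℤ) : ℝ) := fun j => by
        have := mulVec_cast (A := A) (b - a) j
        rw [this, Matrix.mulVec_sub, Pi.sub_apply]
        push_cast
        simp [p]
      -- If some ⟨β, α_j^∨⟩ with j in J is positive, s_j preserves Q and strictly lowers the height,
      -- which stays nonnegative.
      by_cases hex : ∃ j ∈ J, 0 < A.entry.mulVec b j
      · obtain ⟨j, hj, ht⟩ := hex
        obtain ⟨hb', hbJ'⟩ := R.slice_simpleRefl hα hJ hb hbJ hj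
        set t := A.entry.mulVec b j with htdef
        have hb0' := R.nonneg_of_mem_posRoots hb'
        have hsum' : ∑ i, (b - Pi.single j t : ι → ℤ) i = ∑ i, b i - t := by
          simp [Finset.sum_sub_distrib]
        have h0 : 0 ≤ ∑ i, (b - Pi.single j t : ι → ℤ) i := Finset.sum_nonneg fun i _ => hb0' i
        have h1 := ih _ (by rw [← hn]; omega) _ hb' hbJ' rfl
        have h2 : (b - Pi.single j t - a : ι → ℤ) = b - a - Pi.single j t := by abel
        rw [h2, cast_sub_single] at h1
        refine le_of_eq_of_le ?_ h1
        simp only [Q]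
        rw [form_sub_single hsymm hsupp hj]
        have h3 := hsum j
        have h4 : ∑ i, d i * p i *
            ((fun i => ((b - a) i : ℝ)) - (t : ℝ) • (Pi.single j 1 : ι → ℝ)) i =
            ∑ i, d i * p i * ((b - a) i : ℝ) - d j * p j * t := by
          simp only [Pi.sub_apply, Pi.smul_apply, smul_eq_mul, mul_sub, Finset.sum_sub_distrib]
          congr 1
          rw [Finset.sum_eq_single j]
          · simp
          · intro i _ hi; simp [hi]
          · simp
        rw [h4]
        linear_combination (2 * (t : ℝ) * d j) * h3
      · push Not at hex
        -- For β antidominant on J, Q is the sum of d_i x_i (⟨β, α_i^∨⟩ + ⟨α, α_i^∨⟩), with x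
        -- nonnegative and both pairings nonpositive on J.
        have h1 : Q (fun i => ((b - a) i : ℝ)) =
            ∑ i, (d i * ((b - a) i : ℝ) * ((A.entry.mulVec b i : ℤ) : ℝ) +
              d i * p i * ((b - a) i : ℝ)) := by
          simp only [Q, GCM.form, Finset.mul_sum (a := (2 : ℝ)), ← Finset.sum_add_distrib]
          exact Finset.sum_congr rfl fun i _ => by
            linear_combination (d i * ((b - a) i : ℝ)) * hsum i
        rw [h1]
        refine Finset.sum_nonpos fun i _ => ?_
        by_cases hi : i ∈ J
        · have h2 : (0 : ℝ) ≤ ((b - a) i : ℝ) := by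
            rw [Pi.sub_apply, hJ i hi, sub_zero]; exact_mod_cast hb0 i
          have h3 : ((A.entry.mulVec b i : ℤ) : ℝ) ≤ 0 := by exact_mod_cast hex i hi
          have h4 := mul_nonneg (hd i).le h2
          have h5 := mul_nonpos_of_nonneg_of_nonpos h4 h3
          have h6 := mul_nonpos_of_nonneg_of_nonpos h4 (hp i hi)
          linarith
        · rw [hsupp i hi]; simp
  have hfin := finite_of_form_le hpos (K := 2 * ∑ i, d i * |p i|)
    (mul_nonneg zero_le_two (Finset.sum_nonneg fun i _ => mul_nonneg (hd i).le (abs_nonneg _)))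
  refine (hfin.image fun c => R.ofInt (c + a)).subset fun β hβ => ?_
  obtain ⟨b, rfl, hb, hbJ⟩ := R.exists_ofInt_of_mem_slice hβ
  refine ⟨b - a, ⟨fun i hi => by simp [hbJ i hi], ?_⟩, by simp⟩
  have h1 := hQ _ b hb hbJ rfl
  simp only [Q] at h1
  set x : ι → ℝ := fun i => ((b - a) i : ℝ) with hx
  have h2 : -∑ i, d i * p i * x i ≤ (∑ i, d i * |p i|) * ‖x‖ := by
    rw [← Finset.sum_neg_distrib, Finset.sum_mul]
    refine Finset.sum_le_sum fun i _ => ?_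
    have h3 : |x i| ≤ ‖x‖ := by simpa using norm_le_pi_norm x i
    calc -(d i * p i * x i) ≤ |d i * p i * x i| := neg_le_abs _
      _ = d i * |p i| * |x i| := by rw [abs_mul, abs_mul, abs_of_pos (hd i)]
      _ ≤ d i * |p i| * ‖x‖ := by
        have := hd i
        gcongr
  have h4 : 0 ≤ ∑ i, d i * |p i| :=
    Finset.sum_nonneg fun i _ => mul_nonneg (hd i).le (abs_nonneg _)
  have h5 : (fun i => ((b - a) i : ℝ)) = x := rfl
  nlinarith

/-- In finite type the parabolic subgroup is finite. -/
theorem parabolic_finite {J : Set ι} (hfin : A.FiniteTypeOn J) :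
    (R.parabolic J : Set (Module.Dual ℂ 𝔥 ≃ₗ[ℂ] Module.Dual ℂ 𝔥)).Finite := by
  classical
  obtain ⟨d, hd, hsymm, hpos⟩ := id hfin
  have hK : 0 ≤ ∑ j, 2 * d j := Finset.sum_nonneg fun i _ => mul_nonneg zero_le_two (hd i).le
  -- The form is reflection-invariant, so any bound gives a stable set; this one admits every simple
  -- root of J, since α_j has norm 2 d_j.
  let X : Set (ι → ℤ) := {c | (∀ i ∉ J, c i = 0) ∧
    A.form d (fun i => (c i : ℝ)) (fun i => (c i : ℝ)) ≤ ∑ j, 2 * d j}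
  have hX : X.Finite := (finite_of_form_le hpos hK).subset fun c hc => ⟨hc.1, by
    have := hc.2
    have hn := norm_nonneg fun i => (c i : ℝ)
    nlinarith⟩
  have hstable : ∀ j ∈ J, ∀ μ ∈ R.ofInt '' X, R.simpleRefl j μ ∈ R.ofInt '' X := by
    rintro j hj _ ⟨c, hc, rfl⟩
    refine ⟨_, ⟨fun i hi => ?_, ?_⟩, (R.simpleRefl_ofInt c j).symm⟩
    · have : i ≠ j := by rintro rfl; exact hi hj
      simpa [this] using hc.1 i hi
    · rw [cast_sub_single, form_sub_single hsymm (fun i hi => by simp [hc.1 i hi]) hj, mulVec_cast]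
      have := hc.2
      linarith
  have hroot : ∀ j ∈ J, R.root j ∈ R.ofInt '' X := by
    intro j hj
    refine ⟨Pi.single j 1, ⟨fun i hi => ?_, ?_⟩, (R.root_eq_ofInt j).symm⟩
    · have : i ≠ j := by rintro rfl; exact hi hj
      simp [this]
    · have h1 : (fun i => (((Pi.single j 1 : ι → ℤ) i : ℤ) : ℝ)) = Pi.single j 1 := by
        funext i
        by_cases hij : i = j
        · subst hij; simp
        · simp [hij]
      rw [h1, form_single_left]
      have h2 : ∑ k, (A.entry j k : ℝ) * (Pi.single j 1 : ι → ℝ) k = 2 := by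
        simp [Pi.single_apply, A.diag]
      rw [h2, mul_comm]
      exact Finset.single_le_sum (f := fun j => 2 * d j)
        (fun i _ => mul_nonneg zero_le_two (hd i).le) (Finset.mem_univ j)
  let Φ : (Module.Dual ℂ 𝔥 ≃ₗ[ℂ] Module.Dual ℂ 𝔥) → J → Module.Dual ℂ 𝔥 := fun w j => w (R.root j)
  have hfinpi : (Set.univ.pi fun _ : J => R.ofInt '' X).Finite :=
    Set.Finite.pi fun _ => hX.image _
  refine Set.Finite.of_finite_image (f := Φ) (hfinpi.subset ?_) ?_
  · rintro _ ⟨w, hw, rfl⟩ j -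
    exact R.parabolic_mem_of_stable hstable hw (hroot j j.2)
  · intro w hw w' hw' hww'
    refine LinearEquiv.ext fun μ => ?_
    -- Nonsingularity splits μ into a combination of the α_j with j in J and a vector ν orthogonal
    -- to all coroots of J. As W_J fixes ν, an element is determined by its values on those α_j.
    obtain ⟨c, hcJ, hc⟩ := hfin.exists_solution fun i => μ (R.coroot i)
    set ν := μ - ∑ i, c i • R.root i with hν
    have hfix : ∀ j ∈ J, ∀ ν' ∈ ({ν} : Set (Module.Dual ℂ 𝔥)),
        R.simpleRefl j ν' ∈ ({ν} : Set (Module.Dual ℂ 𝔥)) := by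
      rintro j hj _ rfl
      have h0 : ν (R.coroot j) = 0 := by
        rw [hν, LinearMap.sub_apply, LinearMap.sum_apply, ← hc j hj, sub_eq_zero]
        exact Finset.sum_congr rfl fun i _ => by
          rw [LinearMap.smul_apply, R.root_coroot, smul_eq_mul, mul_comm]
      rw [Set.mem_singleton_iff, simpleRefl_apply, h0, zero_smul, sub_zero]
    have h1 : w ν = ν := R.parabolic_mem_of_stable hfix hw rfl
    have h2 : w' ν = ν := R.parabolic_mem_of_stable hfix hw' rfl
    have h3 : μ = ν + ∑ i, c i • R.root i := by rw [hν, sub_add_cancel]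
    rw [h3, map_add, map_add, h1, h2, map_sum, map_sum]
    congr 1
    refine Finset.sum_congr rfl fun i _ => ?_
    by_cases hi : i ∈ J
    · rw [map_smul, map_smul]
      exact congrArg _ (congrFun hww' ⟨i, hi⟩)
    · rw [hcJ i hi, zero_smul, map_zero, map_zero]

end Realization

namespace SerreData

open GCM

variable {ι : Type*} [Fintype ι] {A : GCM ι} {𝔥 : Type*} [AddCommGroup 𝔥] [Module ℂ 𝔥]
  {R : Realization A 𝔥} {L : Type*} [LieRing L] [LieAlgebra ℂ L] (D : SerreData R L)

/-- In finite type there are finitely many positive roots. -/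
theorem finite_isRoot_nonneg (hfin : A.FiniteTypeOn Set.univ) :
    {c : ι → ℤ | D.IsRoot (R.ofInt c) ∧ 0 ≤ c}.Finite := by
  classical
  obtain ⟨d, hd, hsymm, hpos⟩ := hfin
  have hsupp : ∀ c : ι → ℤ, ∀ i ∉ (Set.univ : Set ι), (c i : ℝ) = 0 := by simp
  have key : ∀ (n : ℕ) (c : ι → ℤ), D.IsRoot (R.ofInt c) → 0 ≤ c → (∑ i, c i).toNat = n →
      A.form d (fun i => (c i : ℝ)) (fun i => (c i : ℝ)) ≤ ∑ j, 2 * d j := by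
    intro n
    induction n using Nat.strong_induction_on with
    | _ n ih =>
      intro c hc hc0 hn
      obtain ⟨i₀, hi₀⟩ := D.exists_pos_of_nonneg hc hc0
      have hne : (fun i => (c i : ℝ)) ≠ 0 := fun h => by
        have := congrFun h i₀
        simp only [Pi.zero_apply, Int.cast_eq_zero] at this
        omega
      -- Positive norm forces a node of the support with positive pairing.
      obtain ⟨j, hcj, ht⟩ : ∃ j, 0 < c j ∧ 0 < A.entry.mulVec c j := by
        by_contra! hcon
        refine (hpos _ (hsupp c) hne).not_ge (Finset.sum_nonpos fun i _ => ?_)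
        rw [mulVec_cast]
        rcases (hc0 i).eq_or_lt with h | h
        · simp [← h]
        · have h1 : ((A.entry.mulVec c i : ℤ) : ℝ) ≤ 0 := by exact_mod_cast hcon i h
          have h2 : (0 : ℝ) ≤ c i := by exact_mod_cast hc0 i
          exact mul_nonpos_of_nonneg_of_nonpos (mul_nonneg (hd i).le h2) h1
      -- A second positive coordinate keeps the reflected root positive and the induction descends;
      -- without one, the root is simple.
      by_cases hk : ∃ k, k ≠ j ∧ 0 < c k
      · obtain ⟨k, hkj, hck⟩ := hk
        have hb' := D.isRoot_sub_single hc j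
        have hb0' := D.nonneg_of_pos hb' (i := k) (by simpa [hkj] using hck)
        set t := A.entry.mulVec c j with htdef
        have hsum' : ∑ i, (c - Pi.single j t : ι → ℤ) i = ∑ i, c i - t := by
          simp [Finset.sum_sub_distrib]
        have h0 : 0 ≤ ∑ i, (c - Pi.single j t : ι → ℤ) i := Finset.sum_nonneg fun i _ => hb0' i
        have h1 := ih _ (by rw [← hn]; omega) _ hb' hb0' rfl
        rw [cast_sub_single, form_sub_single hsymm (hsupp c) (Set.mem_univ j), mulVec_cast] at h1
        linarith
      · push Not at hk
        have hcs := D.eq_single_of_support hc hcj (j := j) fun i hi => by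
          by_contra hij
          exact hi (le_antisymm (hk i hij) (hc0 i))
        have h1 : (fun i => (c i : ℝ)) = Pi.single j 1 := by
          rw [hcs]
          funext i
          by_cases hij : i = j
          · subst hij; simp
          · simp [hij]
        rw [h1, form_single_left]
        have h2 : ∑ k, (A.entry j k : ℝ) * (Pi.single j 1 : ι → ℝ) k = 2 := by
          simp [Pi.single_apply, A.diag]
        rw [h2, mul_comm]
        exact Finset.single_le_sum (f := fun j => 2 * d j)
          (fun i _ => mul_nonneg zero_le_two (hd i).le) (Finset.mem_univ j)
  have hK : 0 ≤ ∑ j, 2 * d j := Finset.sum_nonneg fun i _ => mul_nonneg zero_le_two (hd i).le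
  refine (finite_of_form_le hpos hK).subset fun c hc => ⟨by simp, ?_⟩
  have := key _ c hc.1 hc.2 rfl
  have hn := norm_nonneg fun i => (c i : ℝ)
  nlinarith

end SerreData
end

/-! ### From finite orbits to finite type; linked nodes and cosets. -/

noncomputable section

set_option linter.unusedSectionVars false

namespace Realization

open GCM

variable {ι : Type*} [Fintype ι] {A : GCM ι} {𝔥 : Type*} [AddCommGroup 𝔥] [Module ℂ 𝔥]
  (R : Realization A 𝔥)

/-- The real part of the pairing with a simple coroot. -/
def val (μ : Module.Dual ℂ 𝔥) (i : ι) : ℝ := (μ (R.coroot i)).re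

theorem val_simpleRefl (μ : Module.Dual ℂ 𝔥) (i k : ι) :
    R.val (R.simpleRefl i μ) k = R.val μ k - R.val μ i * A.entry k i := by
  simp [val, simpleRefl_apply, R.root_coroot]

theorem val_ofInt (c : ι → ℤ) (i : ι) : R.val (R.ofInt c) i = ((A.entry.mulVec c i : ℤ) : ℝ) := by
  rw [val, ofInt_coroot, Complex.intCast_re]

theorem val_root (i j : ι) : R.val (R.root j) i = A.entry i j := by
  rw [val, root_coroot, Complex.intCast_re]

/-- The form on the coroots attached to a finite set of weights. -/
def corootForm (X : Finset (Module.Dual ℂ 𝔥)) (k i : ι) : ℝ := ∑ μ ∈ X, R.val μ k * R.val μ i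

theorem corootForm_symm (X : Finset (Module.Dual ℂ 𝔥)) (k i : ι) :
    R.corootForm X k i = R.corootForm X i k :=
  Finset.sum_congr rfl fun _ _ => mul_comm _ _

theorem corootForm_self_nonneg (X : Finset (Module.Dual ℂ 𝔥)) (i : ι) :
    0 ≤ R.corootForm X i i :=
  Finset.sum_nonneg fun _ _ => mul_self_nonneg _

/-- Reindexing the sum by s_i, a permutation of X, replaces B(k,i) by a_{ki} B(i,i) − B(k,i). -/
theorem two_mul_corootForm {X : Finset (Module.Dual ℂ 𝔥)} {i : ι}
    (hX : ∀ μ ∈ X, R.simpleRefl i μ ∈ X) (k : ι) :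
    2 * R.corootForm X k i = A.entry k i * R.corootForm X i i := by
  have h : R.corootForm X k i =
      ∑ μ ∈ X, R.val (R.simpleRefl i μ) k * R.val (R.simpleRefl i μ) i :=
    Finset.sum_nbij' (fun μ => R.simpleRefl i μ) (fun μ => R.simpleRefl i μ) hX hX
      (fun μ _ => R.simpleRefl_simpleRefl i μ) (fun μ _ => R.simpleRefl_simpleRefl i μ)
      (fun μ _ => by rw [R.simpleRefl_simpleRefl])
  have h2 : ∑ μ ∈ X, R.val (R.simpleRefl i μ) k * R.val (R.simpleRefl i μ) i =
      A.entry k i * R.corootForm X i i - R.corootForm X k i := by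
    rw [corootForm, corootForm, Finset.mul_sum, ← Finset.sum_sub_distrib]
    refine Finset.sum_congr rfl fun μ _ => ?_
    rw [val_simpleRefl, val_simpleRefl, A.diag]
    push_cast
    ring
  linarith

theorem sum_corootForm (X : Finset (Module.Dual ℂ 𝔥)) (y : ι → ℝ) :
    ∑ i, ∑ j, y i * y j * R.corootForm X i j = ∑ μ ∈ X, (∑ i, y i * R.val μ i) ^ 2 := by
  simp only [corootForm, Finset.mul_sum]
  rw [Finset.sum_congr rfl fun i _ => Finset.sum_comm, Finset.sum_comm]
  refine Finset.sum_congr rfl fun μ _ => ?_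
  rw [sq, Finset.sum_mul_sum]
  exact Finset.sum_congr rfl fun i _ => Finset.sum_congr rfl fun j _ => by ring

/-- A finite stable set of weights that separates the coroots makes `A` of finite type. -/
theorem finiteTypeOn_of_separating {J : Set ι} {X : Finset (Module.Dual ℂ 𝔥)}
    (hX : ∀ j ∈ J, ∀ μ ∈ X, R.simpleRefl j μ ∈ X)
    (hsep : ∀ c : ι → ℝ, (∀ i ∉ J, c i = 0) → (∀ μ ∈ X, ∑ i, c i * R.val μ i = 0) → c = 0) :
    A.FiniteTypeOn J := by
  classical
  have hB : ∀ i ∈ J, 0 < R.corootForm X i i := by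
    intro i hi
    refine (R.corootForm_self_nonneg X i).lt_of_ne' fun h0 => ?_
    have h1 : ∀ μ ∈ X, R.val μ i = 0 := fun μ hμ =>
      mul_self_eq_zero.1 ((Finset.sum_eq_zero_iff_of_nonneg fun μ _ =>
        mul_self_nonneg (R.val μ i)).1 h0 μ hμ)
    have h2 := hsep (Pi.single i 1) (fun k hk => by
      have : k ≠ i := by rintro rfl; exact hk hi
      simp [this]) (fun μ hμ => by
        rw [Finset.sum_eq_single i]
        · simp [h1 μ hμ]
        · intro k _ hk; simp [hk]
        · simp)
    simpa using congrFun h2 i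
  -- With this scaling a_{ij} = d_j B(i,j) for j in J, so d_i a_{ij} = d_i d_j B(i,j) is symmetric
  -- and its quadratic form is a sum of squares.
  let d : ι → ℝ := fun i => if i ∈ J then 2 / R.corootForm X i i else 1
  have hdJ : ∀ i ∈ J, d i = 2 / R.corootForm X i i := fun i hi => if_pos hi
  have hd : ∀ i, 0 < d i := fun i => by
    by_cases hi : i ∈ J
    · rw [hdJ i hi]; exact div_pos two_pos (hB i hi)
    · simp [d, hi]
  have hentry : ∀ i, ∀ j ∈ J, (A.entry i j : ℝ) = d j * R.corootForm X i j := fun i j hj => by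
    have h1 := R.two_mul_corootForm (hX j hj) i
    have h2 := hB j hj
    rw [hdJ j hj]
    field_simp
    linarith
  refine ⟨d, hd, fun i hi j hj => ?_, fun x hx hx0 => ?_⟩
  · rw [hentry i j hj, hentry j i hi, R.corootForm_symm X j i]
    ring
  · let y : ι → ℝ := fun i => d i * x i
    have h1 : A.form d x x = ∑ μ ∈ X, (∑ i, y i * R.val μ i) ^ 2 := by
      rw [← sum_corootForm, GCM.form]
      refine Finset.sum_congr rfl fun i _ => ?_
      rw [Finset.mul_sum]
      refine Finset.sum_congr rfl fun j _ => ?_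
      by_cases hj : j ∈ J
      · rw [hentry i j hj]; simp only [y]; ring
      · simp [y, hx j hj]
    rw [h1]
    refine (Finset.sum_nonneg fun μ _ => sq_nonneg _).lt_of_ne' fun h0 => hx0 ?_
    have h2 := hsep y (fun i hi => by simp [y, hx i hi]) fun μ hμ =>
      pow_eq_zero_iff two_ne_zero |>.1 ((Finset.sum_eq_zero_iff_of_nonneg fun μ _ =>
        sq_nonneg (∑ i, y i * R.val μ i)).1 h0 μ hμ)
    funext i
    exact (mul_eq_zero.1 (congrFun h2 i)).resolve_left (hd i).ne'

/-! ### The nodes linked to a root -/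

/-- The nodes of `J` whose component in the Dynkin diagram of `J` contains a node not orthogonal
to `α`. -/
inductive Linked (α : Module.Dual ℂ 𝔥) (J : Set ι) : ι → Prop
  | base (j : ι) : j ∈ J → α (R.coroot j) ≠ 0 → Linked α J j
  | step (j k : ι) : Linked α J j → k ∈ J → A.entry k j ≠ 0 → Linked α J k

/-- The set of linked nodes. -/
def linkedNodes (α : Module.Dual ℂ 𝔥) (J : Set ι) : Set ι := {j | R.Linked α J j}

theorem Linked.mem {α : Module.Dual ℂ 𝔥} {J : Set ι} {j : ι} (h : R.Linked α J j) : j ∈ J := by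
  cases h <;> assumption

theorem linkedNodes_subset (α : Module.Dual ℂ 𝔥) (J : Set ι) : R.linkedNodes α J ⊆ J :=
  fun _ h => Linked.mem R h

/-- Let c, supported on the linked nodes, be annihilated by every weight of the orbit. The signs of
the Cartan matrix allow replacing c by |c|, and then c vanishes where α pairs nontrivially and, step
by step, along the edges of J. -/
theorem finiteTypeOn_linkedNodes {α : Module.Dual ℂ 𝔥} (hα : α ∈ R.posRoots) {J : Set ι}
    (hJ : J ⊆ (R.supp α)ᶜ) (hfin : (R.orbit J {α}).Finite) :
    A.FiniteTypeOn (R.linkedNodes α J) := by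
  classical
  obtain ⟨a, rfl⟩ := R.exists_ofInt_of_mem_posRoots hα
  rw [R.supp_compl] at hJ
  set α := R.ofInt a with hαdef
  let X := hfin.toFinset
  have hX : ∀ j ∈ J, ∀ μ ∈ X, R.simpleRefl j μ ∈ X := fun j hj μ hμ =>
    hfin.mem_toFinset.2 (R.simpleRefl_mem_orbit (hfin.mem_toFinset.1 hμ) hj)
  have hαX : α ∈ X := hfin.mem_toFinset.2 (R.subset_orbit J _ rfl)
  have hsub := R.linkedNodes_subset α J
  refine R.finiteTypeOn_of_separating (fun j hj => hX j (hsub hj)) fun c hcJ hc => ?_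
  -- Off-diagonal values of the coroot form are nonpositive on the relevant nodes, so its value at
  -- |c| is at most its value at c, which is zero.
  have habs : ∀ μ ∈ X, ∑ i, |c i| * R.val μ i = 0 := by
    have h1 : ∑ μ ∈ X, (∑ i, |c i| * R.val μ i) ^ 2 ≤ 0 := by
      rw [← sum_corootForm]
      have h2 : ∑ i, ∑ j, c i * c j * R.corootForm X i j = 0 := by
        rw [sum_corootForm]
        exact Finset.sum_eq_zero fun μ hμ => by rw [hc μ hμ, sq, mul_zero]
      rw [← h2]
      refine Finset.sum_le_sum fun i _ => Finset.sum_le_sum fun j _ => ?_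
      rw [← abs_mul]
      by_cases hij : i = j
      · subst hij
        rw [abs_mul_self]
      · by_cases hj : j ∈ R.linkedNodes α J
        · have h3 := R.two_mul_corootForm (hX j (hsub hj)) i
          have h4 : (A.entry i j : ℝ) ≤ 0 := by exact_mod_cast A.nonpos i j hij
          have h5 := mul_nonpos_of_nonpos_of_nonneg h4 (R.corootForm_self_nonneg X j)
          exact mul_le_mul_of_nonpos_right (le_abs_self _) (by linarith)
        · simp [hcJ j hj]
    have h2 : ∑ μ ∈ X, (∑ i, |c i| * R.val μ i) ^ 2 = 0 :=
      le_antisymm h1 (Finset.sum_nonneg fun μ _ => sq_nonneg _)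
    exact fun μ hμ => pow_eq_zero_iff two_ne_zero |>.1
      ((Finset.sum_eq_zero_iff_of_nonneg fun μ _ => sq_nonneg _).1 h2 μ hμ)
  have hval : ∀ j ∈ J, R.val α j ≤ 0 := fun j hj => by
    rw [hαdef, val_ofInt]
    exact Int.cast_nonpos.2 (sum_entry_nonpos (R.nonneg_of_mem_posRoots hα) (hJ j hj))
  -- Carrying along a weight μ of X with μ(α_j^∨) ≠ 0 makes the induction work: comparing the
  -- relations at μ and s_j μ gives ∑ |c_i| a_{ij} = 0. As c_j = 0, all terms have one sign, so c_k
  -- = 0 at neighbours k; and μ or s_j μ is nonzero on α_k^∨.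
  have key : ∀ j, R.Linked α J j → c j = 0 ∧ ∃ μ ∈ X, R.val μ j ≠ 0 := by
    intro j hj
    induction hj with
    | base j hj hne =>
      have hv : R.val α j ≠ 0 := by
        rw [hαdef, ofInt_coroot] at hne
        rw [hαdef, val_ofInt]
        exact_mod_cast hne
      refine ⟨?_, α, hαX, hv⟩
      have h1 := habs α hαX
      rw [← neg_eq_zero, ← Finset.sum_neg_distrib] at h1
      have h2 := (Finset.sum_eq_zero_iff_of_nonneg fun i _ => by
        by_cases hi : i ∈ R.linkedNodes α J
        · have := mul_nonpos_of_nonneg_of_nonpos (abs_nonneg (c i)) (hval i (hsub hi))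
          linarith
        · simp [hcJ i hi]).1 h1 j (Finset.mem_univ j)
      simpa [hv] using h2
    | step j k hj hk hkj ih =>
      obtain ⟨hcj, μ, hμ, hμj⟩ := ih
      have hjJ := Linked.mem R hj
      constructor
      · have h1 := habs _ (hX j hjJ μ hμ)
        simp only [val_simpleRefl, mul_sub, Finset.sum_sub_distrib] at h1
        rw [habs μ hμ, zero_sub, neg_eq_zero] at h1
        have h2 : R.val μ j * ∑ i, |c i| * (-(A.entry i j : ℝ)) = 0 := by
          rw [← neg_eq_zero, ← h1, Finset.mul_sum, ← Finset.sum_neg_distrib]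
          exact Finset.sum_congr rfl fun i _ => by ring
        have h3 := (Finset.sum_eq_zero_iff_of_nonneg fun i _ => by
          by_cases hij : i = j
          · subst hij; simp [hcj]
          · have : (A.entry i j : ℝ) ≤ 0 := by exact_mod_cast A.nonpos i j hij
            exact mul_nonneg (abs_nonneg _) (by linarith)).1
          ((mul_eq_zero.1 h2).resolve_left hμj) k (Finset.mem_univ k)
        have h4 : (A.entry k j : ℝ) ≠ 0 := by exact_mod_cast hkj
        simpa [h4] using h3
      · by_cases h0 : R.val μ k = 0
        · refine ⟨_, hX j hjJ μ hμ, ?_⟩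
          rw [val_simpleRefl, h0, zero_sub, neg_ne_zero]
          exact mul_ne_zero hμj (by exact_mod_cast hkj)
        · exact ⟨μ, hμ, h0⟩
  funext i
  by_cases hi : i ∈ R.linkedNodes α J
  · exact (key i hi).1
  · exact hcJ i hi

/-- Since a vanishes at t, the pairing with α_t^∨ is a sum of nonpositive terms, so each term is
zero. -/
theorem entry_eq_zero_of_orthogonal {a : ι → ℤ} (ha : 0 ≤ a) {t : ι} (ht : a t = 0)
    (h : R.ofInt a (R.coroot t) = 0) {s : ι} (hs : a s ≠ 0) : A.entry s t = 0 := by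
  rw [ofInt_coroot, Int.cast_eq_zero, Matrix.mulVec, dotProduct, ← neg_eq_zero,
    ← Finset.sum_neg_distrib] at h
  have h1 := (Finset.sum_eq_zero_iff_of_nonneg fun i _ => by
    by_cases hti : t = i
    · subst hti; simp [ht]
    · have := mul_nonpos_of_nonpos_of_nonneg (A.nonpos t i hti) (ha i)
      linarith).1 h s (Finset.mem_univ s)
  exact A.zero_symm t s (by simpa [hs] using h1)

/-- The set supp α ∪ L is orthogonal to J ∖ L. The connected support of β meets supp α, which is
disjoint from J, so it avoids J ∖ L. -/
theorem slice_eq_slice_linkedNodes {α : Module.Dual ℂ 𝔥} (hα : α ∈ R.posRoots) {J : Set ι}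
    (hJ : J ⊆ (R.supp α)ᶜ) : R.slice α J = R.slice α (R.linkedNodes α J) := by
  refine Set.Subset.antisymm (fun β hβ => ?_) (R.slice_mono α (R.linkedNodes_subset α J))
  obtain ⟨a, rfl⟩ := R.exists_ofInt_of_mem_posRoots hα
  obtain ⟨b, rfl, hb, hbJ⟩ := R.exists_ofInt_of_mem_slice hβ
  rw [R.supp_compl] at hJ
  set α := R.ofInt a
  have hsplit := R.support_connected hb (S := {i | a i ≠ 0} ∪ R.linkedNodes α J)
    (T := J \ R.linkedNodes α J) (by
      rintro s hs t ⟨htJ, ht⟩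
      rcases hs with hs | hs
      · refine R.entry_eq_zero_of_orthogonal (R.nonneg_of_mem_posRoots hα) (hJ t htJ) ?_ hs
        by_contra hne
        exact ht (Linked.base t htJ hne)
      · by_contra hne
        exact ht (Linked.step s t hs htJ fun h => hne (A.zero_symm t s h))) (fun i hi => by
      by_cases hiJ : i ∈ J
      · by_cases hl : i ∈ R.linkedNodes α J
        · exact Or.inl (Or.inr hl)
        · exact Or.inr ⟨hiJ, hl⟩
      · exact Or.inl (Or.inl (by rwa [Set.mem_ofPred_eq, ← hbJ i hiJ])))
  obtain ⟨k, hk⟩ := R.exists_pos_of_mem_posRoots hα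
  have hkJ : k ∉ J := fun h => by have := hJ k h; omega
  have hS := hsplit.resolve_right fun h => hkJ (h k (by rw [hbJ k hkJ]; omega)).1
  refine R.mem_slice_iff.2 ⟨hb, fun i hi => ?_⟩
  by_cases hiJ : i ∈ J
  · rw [hJ i hiJ]
    by_contra hne
    rcases hS i hne with h | h
    · exact h (hJ i hiJ)
    · exact hi h
  · exact hbJ i hiJ

/-- In a connected `J`, a nontrivial slice determines `J`. -/
theorem eq_of_slice_eq {α : Module.Dual ℂ 𝔥} (hα : α ∈ R.posRoots) {J : Set ι}
    (hJ : J ⊆ (R.supp α)ᶜ) (hconn : (A.dynkin.induce J).Connected) (hne : {α} ⊂ R.slice α J)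
    {K : Set ι} (hK : K ⊆ J) (heq : R.slice α J = R.slice α K) : K = J := by
  classical
  refine Set.Subset.antisymm hK fun j hj => ?_
  -- A nontrivial slice forces some linked node, and connectedness of J spreads linkedness to every
  -- node.
  have hlink : R.Linked α J j := by
    obtain ⟨i, hi⟩ : (R.linkedNodes α J).Nonempty := by
      rw [Set.nonempty_iff_ne_empty]
      intro h
      rw [R.slice_eq_slice_linkedNodes hα hJ, h, R.slice_empty hα] at hne
      exact hne.ne rfl
    have hwalk : ∀ u v : J, (A.dynkin.induce J).Walk u v → R.Linked α J u → R.Linked α J v := by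
      intro u v p
      induction p with
      | nil => exact id
      | cons h p ih =>
        intro hu
        refine ih (.step _ _ hu (Subtype.coe_prop _) ?_)
        rcases (SimpleGraph.induce_adj.1 h).2 with h | h
        · exact fun h0 => h (A.zero_symm _ _ h0)
        · exact h
    obtain ⟨p⟩ := hconn.preconnected ⟨i, Linked.mem R hi⟩ ⟨j, hj⟩
    exact hwalk _ _ p hi
  obtain ⟨a, rfl⟩ := R.exists_ofInt_of_mem_posRoots hα
  rw [R.supp_compl] at hJ
  -- Each linked node occurs in some root of the slice: where the coordinate is still zero, the
  -- pairing is negative because of α or of a neighbour in the support, and reflecting makes the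
  -- coordinate positive.
  have hpos : ∃ b, R.ofInt b ∈ R.slice (R.ofInt a) J ∧ 0 < b j := by
    clear hj
    induction hlink with
    | base j hj hne =>
      obtain ⟨hb, hbJ⟩ := R.slice_simpleRefl hα hJ hα (fun _ _ => rfl) hj
      refine ⟨_, R.mem_slice_iff.2 ⟨hb, hbJ⟩, ?_⟩
      have h1 := sum_entry_nonpos (A := A) (R.nonneg_of_mem_posRoots hα) (hJ j hj)
      rw [ofInt_coroot, Int.cast_ne_zero] at hne
      simp only [Pi.sub_apply, Pi.single_eq_same, hJ j hj]
      omega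
    | step j k _ hk hkj ih =>
      obtain ⟨b, hb, hbj⟩ := ih
      obtain ⟨hbp, hbJ⟩ := R.mem_slice_iff.1 hb
      have hb0 := R.nonneg_of_mem_posRoots hbp
      rcases (hb0 k).eq_or_lt with h0 | h0
      · obtain ⟨hb', hbJ'⟩ := R.slice_simpleRefl hα hJ hbp hbJ hk
        refine ⟨_, R.mem_slice_iff.2 ⟨hb', hbJ'⟩, ?_⟩
        have h0' : b k = 0 := h0.symm
        have h1 := sum_entry_nonpos (A := A) hb0 h0'
        have h2 : A.entry.mulVec b k ≠ 0 := fun h => by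
          have h3 := R.entry_eq_zero_of_orthogonal hb0 h0' (by rw [ofInt_coroot, h, Int.cast_zero])
            (s := j) hbj.ne'
          exact hkj (A.zero_symm j k h3)
        simp only [Pi.sub_apply, Pi.single_eq_same, h0']
        omega
      · exact ⟨b, hb, h0⟩
  obtain ⟨b, hb, hbj⟩ := hpos
  rw [heq] at hb
  by_contra hjK
  have := (R.mem_slice_iff.1 hb).2 j hjK
  have := hJ j hj
  omega

/-! ### Cosets -/

theorem parabolic_mono {J K : Set ι} (h : J ⊆ K) : R.parabolic J ≤ R.parabolic K :=
  Subgroup.closure_mono (Set.image_mono h)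

theorem simpleRefl_commute {i j : ι} (hij : A.entry i j = 0) (hji : A.entry j i = 0) :
    R.simpleRefl i * R.simpleRefl j = R.simpleRefl j * R.simpleRefl i := by
  refine LinearEquiv.ext fun μ => ?_
  simp only [LinearEquiv.mul_apply, simpleRefl_apply, LinearMap.sub_apply, LinearMap.smul_apply,
    R.root_coroot, hij, hji, Int.cast_zero, smul_zero, sub_zero]
  abel

/-- Reflections at unlinked nodes are orthogonal to α and commute with those at linked nodes, so
they can be collected on the right. -/
theorem exists_mul_of_mem_parabolic {α : Module.Dual ℂ 𝔥} {J : Set ι}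
    {w : Module.Dual ℂ 𝔥 ≃ₗ[ℂ] Module.Dual ℂ 𝔥} (hw : w ∈ R.parabolic J) :
    ∃ u ∈ R.parabolic (R.linkedNodes α J), ∃ v ∈ R.parabolic (R.orthNodes α J), w = u * v := by
  have hcases : ∀ s ∈ R.simpleRefl '' J, s ∈ R.parabolic (R.linkedNodes α J) ∨
      (s ∈ R.parabolic (R.orthNodes α J) ∧
        ∀ u ∈ R.parabolic (R.linkedNodes α J), s * u = u * s) := by
    rintro _ ⟨j, hj, rfl⟩
    by_cases hl : R.Linked α J j
    · exact Or.inl (R.simpleRefl_mem_parabolic hl)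
    · refine Or.inr ⟨R.simpleRefl_mem_parabolic ⟨hj, ?_⟩, fun u hu => ?_⟩
      · by_contra hne
        exact hl (.base j hj hne)
      · have hle : R.parabolic (R.linkedNodes α J) ≤ Subgroup.centralizer {R.simpleRefl j} := by
          refine (Subgroup.closure_le _).2 ?_
          rintro _ ⟨k, hk, rfl⟩
          have h0 : A.entry j k = 0 := by
            by_contra hne
            exact hl (.step k j hk hj hne)
          exact Subgroup.mem_centralizer_singleton_iff.2
            (R.simpleRefl_commute (A.zero_symm j k h0) h0)
        exact (Subgroup.mem_centralizer_singleton_iff.1 (hle hu)).symm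
  induction hw using Subgroup.closure_induction_left with
  | one => exact ⟨1, one_mem _, 1, one_mem _, (one_mul 1).symm⟩
  | mul_left s hs w _ ih =>
    obtain ⟨u, hu, v, hv, rfl⟩ := ih
    rcases hcases s hs with h | ⟨h, hcomm⟩
    · exact ⟨s * u, mul_mem h hu, v, hv, (mul_assoc _ _ _).symm⟩
    · exact ⟨u, hu, s * v, mul_mem h hv, by rw [← mul_assoc, hcomm u hu, mul_assoc]⟩
  | inv_mul_cancel s hs w _ ih =>
    obtain ⟨u, hu, v, hv, rfl⟩ := ih
    rcases hcases s hs with h | ⟨h, hcomm⟩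
    · exact ⟨s⁻¹ * u, mul_mem (inv_mem h) hu, v, hv, (mul_assoc _ _ _).symm⟩
    · refine ⟨u, hu, s⁻¹ * v, mul_mem (inv_mem h) hv, ?_⟩
      rw [← mul_assoc, ← mul_assoc]
      congr 1
      rw [inv_mul_eq_iff_eq_mul, ← mul_assoc, hcomm u hu, mul_assoc, mul_inv_cancel, mul_one]

theorem finite_cosets {α : Module.Dual ℂ 𝔥} {J : Set ι}
    (hfin : A.FiniteTypeOn (R.linkedNodes α J)) : Finite (R.cosets α J) := by
  have : Finite (R.parabolic (R.linkedNodes α J)) := (R.parabolic_finite hfin).to_subtype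
  let φ : R.parabolic (R.linkedNodes α J) → R.cosets α J := fun u =>
    QuotientGroup.mk (⟨u, R.parabolic_mono (R.linkedNodes_subset α J) u.2⟩ : R.parabolic J)
  refine Finite.of_surjective φ fun q => ?_
  obtain ⟨⟨w, hw⟩, rfl⟩ := QuotientGroup.mk_surjective q
  obtain ⟨u, hu, v, hv, rfl⟩ := R.exists_mul_of_mem_parabolic (α := α) hw
  refine ⟨⟨u, hu⟩, QuotientGroup.eq.2 ?_⟩
  rw [Subgroup.mem_subgroupOf]
  simpa using hv

/-- The subgroup fixes α, so w ↦ wα factors through the cosets. -/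
theorem orbit_finite_of_finite_cosets {α : Module.Dual ℂ 𝔥} {J : Set ι}
    (h : Finite (R.cosets α J)) : (R.orbit J {α}).Finite := by
  refine (Set.finite_range fun q : R.cosets α J =>
    (q.out : Module.Dual ℂ 𝔥 ≃ₗ[ℂ] Module.Dual ℂ 𝔥) α).subset ?_
  rintro _ ⟨w, hw, ν, hν, rfl⟩
  rw [Set.mem_singleton_iff.1 hν]
  refine ⟨QuotientGroup.mk (⟨w, hw⟩ : R.parabolic J), ?_⟩
  obtain ⟨v, hv⟩ := QuotientGroup.mk_out_eq_mul
    ((R.parabolic (R.orthNodes α J)).subgroupOf (R.parabolic J)) (⟨w, hw⟩ : R.parabolic J)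
  have hfix := R.parabolic_mem_of_stable (J := R.orthNodes α J) (X := {α}) (by
    rintro j ⟨-, hj⟩ μ hμ
    rw [Set.mem_singleton_iff.1 hμ, Set.mem_singleton_iff, simpleRefl_apply, hj, zero_smul,
      sub_zero]) (Subgroup.mem_subgroupOf.1 v.2) (Set.mem_singleton α)
  rw [Set.mem_singleton_iff] at hfix
  beta_reduce
  rw [hv, Subgroup.coe_mul, LinearEquiv.mul_apply, hfix]

end Realization
end

/-! ### Semisimplicity of 𝔤_J and finite type. -/

noncomputable section

open LieAlgebra GCM

set_option linter.unusedSectionVars false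

section

variable {ι : Type*} [Fintype ι] {A : GCM ι} {𝔥 : Type*} [AddCommGroup 𝔥] [Module ℂ 𝔥]
  {R : Realization A 𝔥} {L : Type*} [LieRing L] [LieAlgebra ℂ L]

namespace SerreData

variable (D : SerreData R L)

/-- In finite type only finitely many words are nonzero. -/
theorem finite_range_word (hfin : A.FiniteTypeOn Set.univ) : (Set.range D.word).Finite := by
  classical
  obtain ⟨N, hN⟩ := ((D.finite_isRoot_nonneg hfin).image fun c => ∑ i, c i).bddAbove
  have hlen : {l : List ι | D.word l ≠ 0} ⊆ {l | l.length ≤ N.toNat} := by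
    intro l hl
    have h1 := D.isRoot_of_word_ne_zero hl
    rw [R.rootSum_eq_ofInt] at h1
    have h2 := hN ⟨_, ⟨h1, fun i => Int.natCast_nonneg _⟩, rfl⟩
    -- The length of a nonzero word is the height of a positive root, and these heights are bounded.
    have h3 : ∑ i, (l.count i : ℤ) = l.length := by
      have := Multiset.sum_count_eq_card (s := Finset.univ) (m := (l : Multiset ι)) (by simp)
      simp only [Multiset.coe_count, Multiset.coe_card] at this
      exact_mod_cast this
    simp only [h3] at h2
    rw [Set.mem_ofPred_eq]
    omega
  have hfinl := ((List.finite_length_le ι N.toNat).subset hlen).image D.word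
  refine (hfinl.insert 0).subset ?_
  rintro _ ⟨l, rfl⟩
  by_cases hl : D.word l = 0
  · exact Or.inl hl
  · exact Or.inr ⟨l, hl, rfl⟩

theorem finiteDimensional (D : SerreData R L) (hfin : A.FiniteTypeOn Set.univ) : FiniteDimensional ℂ L := by
  have := R.finite_dim
  have h1 : FiniteDimensional ℂ D.wordSpan :=
    FiniteDimensional.span_of_finite ℂ (D.finite_range_word hfin)
  have h2 : FiniteDimensional ℂ D.swap.wordSpan :=
    FiniteDimensional.span_of_finite ℂ (D.swap.finite_range_word hfin)
  have h3 : FiniteDimensional ℂ D.triangular := by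
    unfold ChevalleyData.triangular
    have h4 : FiniteDimensional ℂ D.toChevalleyData.swap.wordSpan := h2
    infer_instance
  rw [D.triangular_eq_top] at h3
  exact Module.Finite.equiv (Submodule.topEquiv (R := ℂ) (M := L))

/-- A finite-dimensional algebra has finitely many roots. -/
theorem finite_isRoot [FiniteDimensional ℂ L] : {β | D.IsRoot β}.Finite := by
  classical
  choose x hx0 hx using fun β : {β | D.IsRoot β} => β.2.2
  have hli : LinearIndependent ℂ x := by
    rw [linearIndependent_iff']
    intro s g hg β hβ
    have h := weight_part_mem (fun h : 𝔥 => (ad ℂ L (D.H h) : L →ₗ[ℂ] L)) ⊥ (by simp) x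
      (fun β => ⇑(β : Module.Dual ℂ 𝔥)) (fun β h => hx β h) s g (by simpa using hg) ⇑β.1
    have hf : Finset.filter (fun k : {β | D.IsRoot β} => ⇑k.1 = ⇑β.1) s = {β} := by
      ext k
      simp only [Finset.mem_filter, DFunLike.coe_fn_eq, Finset.mem_singleton, Subtype.coe_inj]
      exact ⟨fun h => h.2, fun h => ⟨h ▸ hβ, h⟩⟩
    rw [hf, Finset.sum_singleton, Submodule.mem_bot] at h
    exact (smul_eq_zero.1 h).resolve_right (hx0 β)
  have := hli.finite
  exact Set.toFinite _

end SerreData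

namespace Realization

variable (R)

theorem finrank_eq_card (R : Realization A 𝔥) (hfin : A.FiniteTypeOn Set.univ) :
    Module.finrank ℂ 𝔥 = Fintype.card ι := by
  classical
  have hM : IsUnit A.complexEntry := by
    have h1 : A.extendMatrix Set.univ = A.entry := by ext i j; simp [GCM.extendMatrix]
    have h2 : A.complexEntry.det = Int.castRingHom ℂ A.entry.det :=
      (RingHom.map_det (Int.castRingHom ℂ) A.entry).symm
    rw [Matrix.isUnit_iff_isUnit_det, isUnit_iff_ne_zero, h2, ← h1]
    simpa using det_extendMatrix_ne_zero hfin
  have h := R.finrank_add_rank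
  rw [Matrix.rank_of_isUnit _ hM] at h
  omega

/-- In finite type A is nonsingular, so dim 𝔥 = n and the simple roots span 𝔥^*. -/
theorem exists_root_ne_zero (hfin : A.FiniteTypeOn Set.univ) {h : 𝔥} (hh : h ≠ 0) :
    ∃ j, R.root j h ≠ 0 := by
  by_contra! hcon
  have := R.finite_dim
  have hspan := R.root_linearIndependent.span_eq_top_of_card_eq_finrank'
    (by rw [Subspace.dual_finrank_eq, R.finrank_eq_card hfin])
  refine hh ((Module.forall_dual_apply_eq_zero_iff ℂ h).1 fun φ => ?_)
  have hφ : φ ∈ Submodule.span ℂ (Set.range R.root) := hspan ▸ Submodule.mem_top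
  have hle : Submodule.span ℂ (Set.range R.root) ≤
      LinearMap.ker (Module.Dual.eval ℂ 𝔥 h) := by
    refine Submodule.span_le.2 ?_
    rintro _ ⟨j, rfl⟩
    exact hcon j
  exact hle hφ

theorem coroot_cartan_ne_zero (i : ι) : R.cartan (R.coroot i) ≠ 0 := fun h =>
  R.coroot_linearIndependent.ne_zero i (R.cartan_eq_zero h)

/-- A nonzero ideal contains some h ≠ 0 of 𝔥, hence e_j and f_j for a j with α_j(h) ≠ 0; their
bracket α_j^∨ is nonzero, so the ideal is not abelian. -/
theorem hasTrivialRadical (hfin : A.FiniteTypeOn Set.univ) : HasTrivialRadical ℂ R.KM := by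
  rw [hasTrivialRadical_iff_no_abelian_ideals]
  intro I hI
  refine R.ideal_eq_bot I fun h hh => ?_
  by_contra h0
  obtain ⟨j, hj⟩ := R.exists_root_ne_zero hfin h0
  have he : R.kmData.e j ∈ I := by
    have h1 := lie_mem_left ℂ R.KM I _ (R.kmData.e j) hh
    rw [← kmData_H, R.kmData.lie_H_e] at h1
    exact (I.toSubmodule.smul_mem_iff hj).1 h1
  have hf : R.kmData.f j ∈ I := by
    have h1 := lie_mem_left ℂ R.KM I _ (R.kmData.f j) hh
    rw [← kmData_H, R.kmData.lie_H_f] at h1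
    exact (I.toSubmodule.smul_mem_iff hj).1 (neg_mem_iff.1 h1)
  have h1 := R.kmData.lie_e_f_same j
  have h2 : ⁅(⟨_, he⟩ : I), (⟨_, hf⟩ : I)⁆ = 0 := hI.trivial _ _
  have h3 : ⁅R.kmData.e j, R.kmData.f j⁆ = 0 := congrArg Subtype.val h2
  rw [h3] at h1
  exact R.coroot_cartan_ne_zero j h1.symm

theorem isSemisimple_of_finiteTypeOn (hfin : A.FiniteTypeOn Set.univ) :
    FiniteDimensional ℂ R.KM ∧ IsSemisimple ℂ R.KM := by
  have h1 := R.kmData.finiteDimensional hfin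
  have h2 := R.hasTrivialRadical hfin
  exact ⟨h1, inferInstance⟩

/-- The finite, reflection-stable set of all roots separates the coroots: a combination of coroots
killed by the simple roots is central, and the centre is zero. -/
theorem finiteTypeOn_of_isSemisimple (h1 : FiniteDimensional ℂ R.KM)
    (h2 : IsSemisimple ℂ R.KM) : A.FiniteTypeOn Set.univ := by
  have hfin : R.roots.Finite := R.kmData.finite_isRoot
  refine R.finiteTypeOn_of_separating (X := hfin.toFinset) (fun j _ μ hμ =>
    hfin.mem_toFinset.2 (R.simpleRefl_mem_roots (hfin.mem_toFinset.1 hμ) j)) fun c _ hc => ?_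
  let h : 𝔥 := ∑ i, (c i : ℂ) • R.coroot i
  have hroot : ∀ j, R.root j h = 0 := fun j => by
    have h3 := hc _ (hfin.mem_toFinset.2 (R.root_mem_posRoots j).1)
    simp only [val_root] at h3
    simp only [h, map_sum, map_smul, R.root_coroot, smul_eq_mul]
    exact_mod_cast h3
  have hcent : R.cartan h ∈ center ℂ R.KM := by
    let S : LieSubalgebra ℂ R.KM :=
      { carrier := {y | ⁅R.cartan h, y⁆ = 0}
        zero_mem' := lie_zero _
        add_mem' := fun {y z} hy hz => by
          rw [Set.mem_ofPred_eq] at hy hz ⊢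
          rw [lie_add, hy, hz, add_zero]
        smul_mem' := fun a y hy => by
          rw [Set.mem_ofPred_eq] at hy ⊢
          rw [lie_smul, hy, smul_zero]
        lie_mem' := fun {y z} hy hz => by
          change ⁅R.cartan h, y⁆ = 0 at hy
          change ⁅R.cartan h, z⁆ = 0 at hz
          change ⁅R.cartan h, ⁅y, z⁆⁆ = 0
          rw [leibniz_lie, hy, hz, zero_lie, lie_zero, add_zero] }
    have hS : S = ⊤ := R.kmData.generate S
      (fun i => (R.kmData.lie_H_e h i).trans (by rw [hroot, zero_smul]))
      (fun i => (R.kmData.lie_H_f h i).trans (by rw [hroot, zero_smul, neg_zero]))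
      (fun h' => R.kmData.lie_H_H h h')
    refine (LieModule.mem_maxTrivSubmodule (R := ℂ) (L := R.KM) (M := R.KM) _).2 fun y => ?_
    have hy : y ∈ S := hS ▸ LieSubalgebra.mem_top y
    rw [← lie_skew, neg_eq_zero]
    exact hy
  rw [center_eq_bot, LieSubmodule.mem_bot] at hcent
  have h4 := Fintype.linearIndependent_iff.1 R.coroot_linearIndependent _ (R.cartan_eq_zero hcent)
  funext i
  exact_mod_cast h4 i

end Realization
end

namespace GCM

variable {ι : Type*} [Fintype ι] (A : GCM ι)

theorem sum_subtype_eq {J : Set ι} [Fintype J] {g : ι → ℝ} (hg : ∀ i ∉ J, g i = 0) :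
    ∑ i : J, g i = ∑ i, g i := by
  classical
  rw [← Finset.sum_subtype (Finset.univ.filter (· ∈ J)) (by simp) g]
  refine Finset.sum_subset (Finset.subset_univ _) fun i _ hi => hg i ?_
  simpa using hi

theorem form_restrict {J : Set ι} [Fintype J] (d : ι → ℝ) {x : ι → ℝ} (hx : ∀ i ∉ J, x i = 0) :
    (A.restrict J).form (fun i => d i) (fun i => x i) (fun i => x i) = A.form d x x := by
  rw [form, form, ← sum_subtype_eq (J := J) (fun i hi => by simp [hx i hi])]
  refine Finset.sum_congr rfl fun i _ => ?_
  rw [← sum_subtype_eq (J := J) (fun j hj => by simp [hx j hj])]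
  rfl

theorem finiteTypeOn_restrict {J : Set ι} [Fintype J] :
    (A.restrict J).FiniteTypeOn Set.univ ↔ A.FiniteTypeOn J := by
  classical
  constructor
  · rintro ⟨d, hd, hsymm, hpos⟩
    let d' : ι → ℝ := fun i => if h : i ∈ J then d ⟨i, h⟩ else 1
    have hd' : (fun i : J => d' i) = d := funext fun i => dif_pos i.2
    refine ⟨d', fun i => ?_, fun i hi j hj => ?_, fun x hx hx0 => ?_⟩
    · by_cases h : i ∈ J
      · simpa [d', h] using hd _
      · simp [d', h]
    · simp only [d', dif_pos hi, dif_pos hj]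
      exact hsymm ⟨i, hi⟩ trivial ⟨j, hj⟩ trivial
    · rw [← form_restrict A d' hx, hd']
      refine hpos _ (by simp) fun h0 => hx0 (funext fun i => ?_)
      by_cases h : i ∈ J
      · exact congrFun h0 ⟨i, h⟩
      · exact hx i h
  · rintro ⟨d, hd, hsymm, hpos⟩
    refine ⟨fun i => d i, fun i => hd i, fun i _ j _ => hsymm i i.2 j j.2, fun x _ hx0 => ?_⟩
    let x' : ι → ℝ := fun i => if h : i ∈ J then x ⟨i, h⟩ else 0
    have hx' : (fun i : J => x' i) = x := funext fun i => dif_pos i.2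
    have h0 : ∀ i ∉ J, x' i = 0 := fun i hi => dif_neg hi
    have h1 := form_restrict A d h0
    rw [hx'] at h1
    rw [h1]
    refine hpos x' h0 fun h => hx0 ?_
    rw [← hx', h]
    rfl

/-- `𝔤_J` is semisimple exactly when `A_{J × J}` is of finite type. -/
theorem semisimpleOn_iff {J : Set ι} : A.SemisimpleOn J ↔ A.FiniteTypeOn J := by
  classical
  unfold SemisimpleOn
  constructor
  · rintro ⟨h1, h2⟩
    exact (finiteTypeOn_restrict A).1 (Realization.finiteTypeOn_of_isSemisimple _ h1 h2)
  · intro h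
    exact Realization.isSemisimple_of_finiteTypeOn _ ((finiteTypeOn_restrict A).2 h)

end GCM
end

/-! ### The two criteria. -/

noncomputable section

set_option linter.unusedSectionVars false

namespace Realization

variable {ι : Type*} [Fintype ι] {A : GCM ι} {𝔥 : Type*} [AddCommGroup 𝔥] [Module ℂ 𝔥]
  (R : Realization A 𝔥)

theorem slice_tfae {α : Module.Dual ℂ 𝔥} (hα : α ∈ R.posRoots) {J : Set ι}
    (hJ : J ⊆ (R.supp α)ᶜ) :
    [ (R.slice α J).Finite,
      (R.orbit J {α}).Finite,
      Finite (R.cosets α J),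
      J.Nonempty → ∃ J' ⊆ J, J'.Nonempty ∧ A.SemisimpleOn J' ∧ R.slice α J = R.slice α J'
    ].TFAE := by
  tfae_have 1 → 2 := fun h => h.subset (R.orbit_subset_slice hα hJ)
  tfae_have 2 → 3 := fun h => R.finite_cosets (R.finiteTypeOn_linkedNodes hα hJ h)
  tfae_have 3 → 2 := fun h => R.orbit_finite_of_finite_cosets h
  tfae_have 2 → 4 := by
    rintro h ⟨j, hj⟩
    have heq := R.slice_eq_slice_linkedNodes hα hJ
    rcases (R.linkedNodes α J).eq_empty_or_nonempty with hemp | hne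
    -- With no linked node the slice is {α}, and any single node of J, giving a copy of sl₂, serves
    -- as J'.
    · rw [hemp, R.slice_empty hα] at heq
      refine ⟨{j}, Set.singleton_subset_iff.2 hj, Set.singleton_nonempty j,
        A.semisimpleOn_iff.2 (GCM.finiteTypeOn_singleton j), Set.Subset.antisymm ?_
          (R.slice_mono α (Set.singleton_subset_iff.2 hj))⟩
      rw [heq]
      exact Set.singleton_subset_iff.2 (R.self_mem_slice hα _)
    · exact ⟨_, R.linkedNodes_subset α J, hne,
        A.semisimpleOn_iff.2 (R.finiteTypeOn_linkedNodes hα hJ h), heq⟩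
  tfae_have 4 → 1 := by
    intro h
    rcases J.eq_empty_or_nonempty with rfl | hne
    · rw [R.slice_empty hα]
      exact Set.finite_singleton α
    · obtain ⟨K, hK, -, hss, heq⟩ := h hne
      rw [heq]
      exact R.slice_finite hα (hK.trans hJ) (A.semisimpleOn_iff.1 hss)
  tfae_finish

theorem compl_subset_supp_root {I : Set ι} {i : ι} (hi : i ∈ I) :
    Iᶜ ⊆ (R.supp (R.root i))ᶜ := by
  classical
  rw [root_eq_ofInt, supp_compl]
  intro j hj
  have : j ≠ i := by rintro rfl; exact hj hi
  simp [this]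

theorem heightOn_ofInt (I : Set ι) [DecidablePred (· ∈ I)] (c : ι → ℤ) :
    R.heightOn I (R.ofInt c) = ((∑ i with i ∈ I, c i : ℤ) : ℂ) := by
  rw [heightOn, Finset.sum_filter]
  push_cast
  refine Finset.sum_congr rfl fun i _ => ?_
  by_cases hi : i ∈ I
  · rw [Set.indicator_of_mem hi, coeff_ofInt, if_pos hi]
  · rw [Set.indicator_of_notMem hi, if_neg hi]

/-- The roots of `I`-height one are the disjoint slices through the simple roots of `I`. -/
theorem rootsOfHeight_one (I : Set ι) :
    R.rootsOfHeight I 1 = ⋃ i ∈ I, R.slice (R.root i) Iᶜ := by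
  classical
  ext β
  simp only [Set.mem_iUnion, exists_prop]
  constructor
  · rintro ⟨hβ, hht⟩
    obtain ⟨c, rfl, hc⟩ := R.exists_ofInt_of_mem_roots hβ
    rw [heightOn_ofInt, Int.cast_inj] at hht
    have hc0 : 0 ≤ c := by
      refine hc.resolve_right fun hneg => ?_
      have : ∑ i with i ∈ I, c i ≤ 0 := Finset.sum_nonpos fun i _ => hneg i
      omega
    obtain ⟨i, hi, hpos⟩ : ∃ i ∈ I, 0 < c i := by
      by_contra! hcon
      have : ∑ i with i ∈ I, c i ≤ 0 :=
        Finset.sum_nonpos fun i hi => hcon i (Finset.mem_filter.1 hi).2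
      omega
    refine ⟨i, hi, ?_⟩
    rw [root_eq_ofInt, mem_slice_iff]
    have hiF : i ∈ Finset.univ.filter (· ∈ I) := by simpa using hi
    rw [← Finset.add_sum_erase _ _ hiF] at hht
    have hrest : 0 ≤ ∑ k ∈ (Finset.univ.filter (· ∈ I)).erase i, c k :=
      Finset.sum_nonneg fun k _ => hc0 k
    -- Nonnegative integers with sum 1 and a positive entry at i: that entry is 1 and the others
    -- vanish.
    have hci : c i = 1 := by omega
    have hz := (Finset.sum_eq_zero_iff_of_nonneg fun k _ => hc0 k).1
      (by omega : ∑ k ∈ (Finset.univ.filter (· ∈ I)).erase i, c k = 0)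
    refine ⟨R.mem_posRoots_of_pos hβ hpos, fun k hk => ?_⟩
    have hkI : k ∈ I := not_not.1 hk
    by_cases hki : k = i
    · subst hki; simpa using hci
    · simpa [hki] using hz k (by simp [hki, hkI])
  · rintro ⟨i, hi, hβ⟩
    rw [root_eq_ofInt] at hβ
    obtain ⟨b, rfl, hb, hbI⟩ := R.exists_ofInt_of_mem_slice hβ
    refine ⟨hb.1, ?_⟩
    rw [heightOn_ofInt, Int.cast_inj]
    have h1 : ∀ k ∈ Finset.univ.filter (· ∈ I), b k = (Pi.single i 1 : ι → ℤ) k := fun k hk =>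
      hbI k (not_not.2 (Finset.mem_filter.1 hk).2)
    rw [Finset.sum_congr rfl h1, Finset.sum_eq_single i]
    · simp
    · intro k _ hk; simp [hk]
    · simp [hi]

theorem orbit_image_root (I : Set ι) :
    R.orbit Iᶜ (R.root '' I) = ⋃ i ∈ I, R.orbit Iᶜ {R.root i} := by
  ext μ
  simp only [orbit, Set.mem_iUnion, exists_prop, Set.mem_ofPred_eq]
  constructor
  · rintro ⟨w, hw, _, ⟨i, hi, rfl⟩, rfl⟩
    exact ⟨i, hi, w, hw, _, rfl, rfl⟩
  · rintro ⟨i, hi, w, hw, _, rfl, rfl⟩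
    exact ⟨w, hw, _, ⟨i, hi, rfl⟩, rfl⟩

theorem finite_biUnion_iff {β : Type*} {I : Set ι} {S : ι → Set β} :
    (⋃ i ∈ I, S i).Finite ↔ ∀ i ∈ I, (S i).Finite :=
  ⟨fun h _ hi => h.subset (Set.subset_biUnion_of_mem hi), fun h => I.toFinite.biUnion h⟩

end Realization
end

theorem proposition6p3 {ι : Type*} [Fintype ι] {A : GCM ι}
    {𝔥 : Type*} [AddCommGroup 𝔥] [Module ℂ 𝔥] (R : Realization A 𝔥) :
    -- the criterion for `Δ_{α,J}`
    (∀ α ∈ R.posRoots, ∀ J : Set ι, J ⊆ (R.supp α)ᶜ →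
      [ (R.slice α J).Finite,
        (R.orbit J {α}).Finite,
        Finite (R.cosets α J),
        J.Nonempty → ∃ J' ⊆ J, J'.Nonempty ∧ A.SemisimpleOn J' ∧ R.slice α J = R.slice α J'
      ].TFAE ∧
      ((A.dynkin.induce J).Connected → {α} ⊂ R.slice α J →
        ∀ J' ⊆ J, A.SemisimpleOn J' → R.slice α J = R.slice α J' → J' = J)) ∧
    -- the criterion for `Δ_{I,1}`
    (∀ I : Set ι, I.Nonempty → I ⊂ Set.univ →
      [ (R.rootsOfHeight I 1).Finite,
        (R.orbit Iᶜ (R.root '' I)).Finite,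
        ∀ i ∈ I, Finite (R.cosets (R.root i) Iᶜ),
        ∀ i ∈ I, ∃ J ⊆ Iᶜ, J.Nonempty ∧ A.SemisimpleOn J ∧
          R.slice (R.root i) Iᶜ = R.slice (R.root i) J
      ].TFAE ∧
      ((A.dynkin.induce Iᶜ).Connected → R.root '' I ⊂ R.rootsOfHeight I 1 →
        ((R.rootsOfHeight I 1).Finite → A.SemisimpleOn Iᶜ) ∧
        ∀ i ∈ I, {R.root i} ⊂ R.slice (R.root i) Iᶜ →
          ∀ J ⊆ Iᶜ, A.SemisimpleOn J →
            R.slice (R.root i) Iᶜ = R.slice (R.root i) J → J = Iᶜ)) := by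
  refine ⟨fun α hα J hJ => ⟨R.slice_tfae hα hJ, fun hconn hne K hK _ heq =>
    R.eq_of_slice_eq hα hJ hconn hne hK heq⟩, fun I _ hI => ?_⟩
  have hcompl : (Iᶜ).Nonempty := Set.nonempty_compl.2 hI.ne
  have hT := fun (i : ι) (hi : i ∈ I) =>
    R.slice_tfae (R.root_mem_posRoots i) (R.compl_subset_supp_root hi)
  constructor
  · rw [R.rootsOfHeight_one, R.orbit_image_root, Realization.finite_biUnion_iff,
      Realization.finite_biUnion_iff]
    tfae_have 1 ↔ 2 := forall₂_congr fun i hi => (hT i hi).out 0 1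
    tfae_have 2 ↔ 3 := forall₂_congr fun i hi => (hT i hi).out 1 2
    tfae_have 1 ↔ 4 := forall₂_congr fun i hi =>
      ((hT i hi).out 0 3).trans ⟨fun h => h hcompl, fun h _ => h⟩
    tfae_finish
  · intro hconn hne
    have huniq : ∀ i ∈ I, {R.root i} ⊂ R.slice (R.root i) Iᶜ → ∀ J ⊆ Iᶜ,
        R.slice (R.root i) Iᶜ = R.slice (R.root i) J → J = Iᶜ := fun i hi hss J hJ heq =>
      R.eq_of_slice_eq (R.root_mem_posRoots i) (R.compl_subset_supp_root hi) hconn hss hJ heq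
    refine ⟨fun hfin => ?_, fun i hi hss J hJ _ heq => huniq i hi hss J hJ heq⟩
    obtain ⟨β, hβ, hβI⟩ := Set.exists_of_ssubset hne
    rw [R.rootsOfHeight_one] at hβ hfin
    obtain ⟨i, hi, hβi⟩ := Set.mem_iUnion₂.1 hβ
    -- A root of height one that is not simple makes the slice through this α_i nontrivial, so
    -- uniqueness turns the semisimple subset from (A) into all of Iᶜ.
    have hss : {R.root i} ⊂ R.slice (R.root i) Iᶜ := by
      refine (Set.ssubset_iff_of_subset (Set.singleton_subset_iff.2
        (R.self_mem_slice (R.root_mem_posRoots i) _))).2 ⟨β, hβi, ?_⟩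
      rintro rfl
      exact hβI ⟨i, hi, rfl⟩
    have h4 : (Iᶜ).Nonempty → ∃ K ⊆ Iᶜ, K.Nonempty ∧ A.SemisimpleOn K ∧
        R.slice (R.root i) Iᶜ = R.slice (R.root i) K :=
      ((hT i hi).out 0 3).1 (Realization.finite_biUnion_iff.1 hfin i hi)
    obtain ⟨K, hK, -, hKss, heq⟩ := h4 hcompl
    rwa [huniq i hi hss K hK heq] at hKss
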